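/- Let $dA=\frac{dx\,dy}{\pi}$, let $\ln$ denote the principal branch of the logarithm, and let contour integrals be normalized by the factor $\frac{1}{2\pi i}$. For a bounded domain $\Omega\subset\mathbb{C}$ with rectifiable boundary (traced by finitely many closed curves of finite length, positively oriented with respect to $\Omega$), with $0\notin\partial\Omega$ and $\Omega=\operatorname{Int}(\operatorname{Cl}(\Omega))$, and for a rational function $h$ that vanishes at $\infty$ and has all its poles in $\Omega$, write $\Omega\in\mathrm{QD}_0(h)$ if $$\int_\Omega \frac{f(w)}{|w|^2}\,dA(w)=\oint_{\partial\Omega} f(w)h(w)\,dw$$ for every $f$ that is analytic in $\Omega$, continuous on $\operatorname{Cl}(\Omega)$ and satisfies $\int_\Omega |f(w)||w|^{-2}\,dA(w)<\infty$. **Theorem.** Let $\alpha,w_0\in\mathbb{C}\setminus\{0\}$, and let $\Omega\subset\mathbb{C}$ be a bounded simply connected domain with $0\notin\Omega$. Then $\Omega\in\mathrm{QD}_0\!\left(\frac{\alpha}{w-w_0}\right)$ if and only if $\alpha$ is real with $0<\alpha\le\pi^2$ and $$\Omega=\{w\in\mathbb{C}\setminus\{0\}:|\ln(w/w_0)|^2<\alpha\}.$$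 -/

import Mathlib

open MeasureTheory

noncomputable section

/-- The contour integral `∮_γ g(w) dw` along a Lipschitz curve `γ : [0,1] → ℂ`, with the usual
factor `2πi` divided out. A Lipschitz curve is differentiable almost everywhere, so this is the
complex line integral. -/
def curveContourIntegral (γ : ℝ → ℂ) (g : ℂ → ℂ) : ℂ :=
  (2 * (Real.pi : ℂ) * Complex.I)⁻¹ * ∫ t in (0 : ℝ)..1, g (γ t) * deriv γ t

/-- The contour integral along a finite family of curves, divided by `2πi`. -/
def cycleContourIntegral {n : ℕ} (γ : Fin n → ℝ → ℂ) (g : ℂ → ℂ) : ℂ :=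
  ∑ i, curveContourIntegral (γ i) g

/-- The winding number of a family of closed curves about a point `z` off the curves. -/
def cycleWindingNumber {n : ℕ} (γ : Fin n → ℝ → ℂ) (z : ℂ) : ℂ :=
  cycleContourIntegral γ (fun w => 1 / (w - z))

/-- `γ` is a positively oriented rectifiable parametrization of the boundary of `Ω`: finitely many
closed curves of finite length (parametrized on `[0,1]` in a Lipschitz way, e.g. proportionally to
arc length) which together trace out exactly `∂Ω`, and which wind once around each point of `Ω` and
do not wind around points of the exterior of `Ω`. Curves may touch themselves or each other, so
that boundaries with cusps and double points are included. -/
structure IsBoundaryCycle {n : ℕ} (γ : Fin n → ℝ → ℂ) (Ω : Set ℂ) : Prop where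
  lipschitz : ∀ i, ∃ K : NNReal, LipschitzOnWith K (γ i) (Set.Icc 0 1)
  closed : ∀ i, γ i 0 = γ i 1
  image_eq : ⋃ i, γ i '' Set.Icc 0 1 = frontier Ω
  winding_interior : ∀ z ∈ Ω, cycleWindingNumber γ z = 1
  winding_exterior : ∀ z ∉ closure Ω, cycleWindingNumber γ z = 0

/-- The class `Rat₀(Ω)` (for `Ω ⊆ ℂ`) of rational functions vanishing at infinity all of whose
poles lie in `Ω`. Numerator and denominator are in lowest terms. -/
structure IsRatZero (Ω : Set ℂ) (h : RatFunc ℂ) : Prop where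
  vanish_infty : h.num.degree < h.denom.degree
  poles : ∀ z : ℂ, h.denom.IsRoot z → z ∈ Ω

/-- The test class `L¹ₐ(Ω; ρ₀)`, `ρ₀(w) = |w|⁻²`: functions holomorphic in `Ω`, continuous on the
closure of `Ω`, and integrable over `Ω` against the weight `ρ₀`. -/
structure IsLogTestFunction (Ω : Set ℂ) (f : ℂ → ℂ) : Prop where
  diffContOnCl : DiffContOnCl ℂ f Ω
  integrable : IntegrableOn (fun w => f w / ((‖w‖ ^ 2 : ℝ) : ℂ)) Ω volume

/-- `Ω ∈ QD₀(h)` for bounded `Ω`: the bounded domain `Ω ⊂ ℂ` is a log-weighted quadrature domain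
with quadrature function `h`. The area measure is `dA = dx dy / π`. -/
structure IsBoundedLQD (Ω : Set ℂ) (h : RatFunc ℂ) : Prop where
  isOpen : IsOpen Ω
  isConnected : IsConnected Ω
  isBounded : Bornology.IsBounded Ω
  interior_closure : interior (closure Ω) = Ω
  zero_notMem_frontier : (0 : ℂ) ∉ frontier Ω
  isRatZero : IsRatZero Ω h
  /-- The boundary is rectifiable, and the quadrature identity
  `∫_Ω f |w|⁻² dA = ∮_{∂Ω} f h dw` holds on the whole test class. Any two boundary cycles of
  `Ω` give the same contour integrals of continuous functions, since they have the same winding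
  numbers off the null set `∂Ω`; one of them serves for all `f`. -/
  quadrature : ∃ (n : ℕ) (γ : Fin n → ℝ → ℂ), IsBoundaryCycle γ Ω ∧
    ∀ f : ℂ → ℂ, IsLogTestFunction Ω f →
      (Real.pi : ℂ)⁻¹ * ∫ w in Ω, f w / ((‖w‖ ^ 2 : ℝ) : ℂ) =
        cycleContourIntegral γ (fun w => f w * h.eval (RingHom.id ℂ) w)

end

/-! The coordinate `w = w₀ * exp ζ` turns `|w|⁻² dA` into plain area, so the theorem says that in
the variable `ζ` a one-point quadrature domain is a disc centred at the origin.

Converse: on the disc of radius `r = √α` the area mean value property gives `r² f(w₀)` for the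
weighted integral, and Cauchy's formula, transplanted by `exp`, gives the same for the contour
integral. The bound `r ≤ π` makes `exp` injective on the open disc.

Forward direction: testing with `1` shows that `α` is a positive real `a`. Testing with `1/(w - z)`
computes the Cauchy transform `T` of the weight outside the closure. Continuity of `T` and `Ω = int
(cl Ω)` carry this to all points off `Ω`, so `D = (w₀ - z) T - a` is continuous and vanishes off `Ω`
(`cauchyTransform_eq_of_notMem`).

Simple connectivity supplies a branch `L` of `log (w/w₀)`. Inside `Ω` the function `z T + conj L` is
holomorphic (`differentiableOn_mul_integral_add_conj`): in the variable `ζ` the kernel `z/(w - z)`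
is `1/(exp u - 1)`, that is, `1/u` plus a holomorphic term, and the Cauchy transform of a disc is
antiholomorphic.

Hence `H = L (z T + conj L) + a z L/(z - w₀)` is holomorphic, while `H - |L|² = L z D/(w₀ - z)` is
small relative to `|L|` near the boundary. A Phragmén–Lindelöf argument gives `Im H = 0`, so `H` is
the constant `H(w₀) = a`. Then `|L|` tends to `√a` at the boundary, which forces `L(Ω)` to be the
disc of radius `√a` (`image_log_branch_eq_ball`). Since `L` inverts `w₀ * exp` there, the disc
cannot contain both `πi` and `-πi`, whence `a ≤ π²`. -/

noncomputable section

open Filter Topology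

/-! ### Circle averages and the Cauchy transform of a disc -/

/-- Integrability in polar coordinates. -/
theorem integrableOn_polarCoord_symm {F : ℂ → ℂ} (hF : Integrable F) :
    IntegrableOn (fun p : ℝ × ℝ => p.1 • F (Complex.polarCoord.symm p)) polarCoord.target := by
  have h1 : Integrable (fun p : ℝ × ℝ => F (Complex.measurableEquivRealProd.symm p)) :=
    (Complex.volume_preserving_equiv_real_prod.symm).integrable_comp_emb
      Complex.measurableEquivRealProd.symm.measurableEmbedding |>.2 hF
  have h2 := (integrableOn_image_iff_integrableOn_abs_det_fderiv_smul volume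
    (s := polarCoord.target) (f := polarCoord.symm) (f' := fderivPolarCoordSymm)
    polarCoord.open_target.measurableSet
    (fun p _ => (hasFDerivAt_polarCoord_symm p).hasFDerivWithinAt)
    polarCoord.symm.injOn (fun p : ℝ × ℝ => F (Complex.measurableEquivRealProd.symm p))).1
    h1.integrableOn
  refine h2.congr_fun (fun p hp => ?_) polarCoord.open_target.measurableSet
  have : 0 < p.1 := hp.1
  simp only [det_fderivPolarCoordSymm, abs_of_pos this,
    Complex.measurableEquivRealProd_symm_polarCoord_symm_apply]

theorem integral_eq_integral_circleAverage {F : ℂ → ℂ} (hF : Integrable F) :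
    ∫ z, F z = ∫ s in Set.Ioi (0 : ℝ), (2 * Real.pi * s) • Real.circleAverage F 0 s := by
  have h := integrableOn_polarCoord_symm hF
  rw [← Complex.integral_comp_polarCoord_symm]
  rw [polarCoord_target] at h ⊢
  rw [Measure.volume_eq_prod, setIntegral_prod _ (by rwa [← Measure.volume_eq_prod])]
  refine setIntegral_congr_fun measurableSet_Ioi fun s _ => ?_
  dsimp only
  rw [integral_smul, Real.circleAverage_eq_integral_add (-Real.pi)]
  rw [intervalIntegral.integral_comp_add_right (fun θ => F (circleMap 0 s θ)) (-Real.pi)]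
  rw [intervalIntegral.integral_of_le (by linarith [Real.pi_pos]), smul_smul]
  have e1 : 0 + -Real.pi = -Real.pi := by ring
  have e2 : 2 * Real.pi + -Real.pi = Real.pi := by ring
  rw [e1, e2, integral_Ioc_eq_integral_Ioo]
  have e3 : 2 * Real.pi * s * (2 * Real.pi)⁻¹ = s := by
    field_simp
  rw [e3]
  congr 2
  ext θ
  congr 1
  simp [circleMap, Complex.exp_mul_I]

theorem setIntegral_ball_eq_integral_circleAverage {F : ℂ → ℂ} {ρ : ℝ}
    (hF : IntegrableOn F (Metric.ball 0 ρ)) :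
    ∫ z in Metric.ball (0 : ℂ) ρ, F z =
      ∫ s in Set.Ioo 0 ρ, (2 * Real.pi * s) • Real.circleAverage F 0 s := by
  rw [← integral_indicator Metric.isOpen_ball.measurableSet,
    integral_eq_integral_circleAverage ((integrable_indicator_iff
      Metric.isOpen_ball.measurableSet).2 hF), ← integral_indicator measurableSet_Ioo,
      ← integral_indicator measurableSet_Ioi]
  congr 1
  ext s
  by_cases h0 : 0 < s
  · by_cases h1 : s < ρ
    · rw [Set.indicator_of_mem (show s ∈ Set.Ioi 0 from h0),
        Set.indicator_of_mem (show s ∈ Set.Ioo 0 ρ from ⟨h0, h1⟩)]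
      congr 1
      refine Real.circleAverage_congr_sphere fun z hz => ?_
      rw [Set.indicator_of_mem]
      simp only [mem_sphere_iff_norm, sub_zero, abs_of_pos h0] at hz
      simpa [hz] using h1
    · rw [Set.indicator_of_mem (show s ∈ Set.Ioi 0 from h0),
        Set.indicator_of_notMem (fun h : s ∈ Set.Ioo 0 ρ => h1 h.2)]
      have : Real.circleAverage ((Metric.ball (0 : ℂ) ρ).indicator F) 0 s =
          Real.circleAverage (fun _ => (0 : ℂ)) 0 s := by
        refine Real.circleAverage_congr_sphere fun z hz => ?_
        rw [Set.indicator_of_notMem]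
        simp only [mem_sphere_iff_norm, sub_zero, abs_of_pos h0] at hz
        simpa [hz] using h1
      rw [this]
      simp [Real.circleAverage_def]
  · rw [Set.indicator_of_notMem (fun h : s ∈ Set.Ioi 0 => h0 h),
      Set.indicator_of_notMem (fun h : s ∈ Set.Ioo 0 ρ => h0 h.1)]

/-- Area mean value property. -/
theorem setIntegral_ball_of_diffContOnCl {F : ℂ → ℂ} {r : ℝ} (hr : 0 < r)
    (hF : DiffContOnCl ℂ F (Metric.ball 0 r)) :
    ∫ z in Metric.ball (0 : ℂ) r, F z = Real.pi * r ^ 2 * F 0 := by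
  have hint : IntegrableOn F (Metric.ball 0 r) :=
    (hF.continuousOn_ball.integrableOn_compact (isCompact_closedBall _ _)).mono_set
      Metric.ball_subset_closedBall
  rw [setIntegral_ball_eq_integral_circleAverage hint]
  have : ∀ s ∈ Set.Ioo 0 r, (2 * Real.pi * s) • Real.circleAverage F 0 s =
      ((2 * Real.pi * s : ℝ) : ℂ) * F 0 := by
    intro s hs
    rw [DiffContOnCl.circleAverage (hF.mono (Metric.ball_subset_ball
      (by rw [abs_of_pos hs.1]; exact hs.2.le)))]
    simp
  rw [setIntegral_congr_fun measurableSet_Ioo this, integral_mul_const, integral_complex_ofReal,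
    ← integral_Ioc_eq_integral_Ioo, ← intervalIntegral.integral_of_le hr.le,
    intervalIntegral.integral_const_mul, integral_id]
  push_cast
  ring

/-- In polar coordinates about `η` the Jacobian cancels the singularity. -/
theorem integrableOn_inv_sub_ball (η : ℂ) (c : ℂ) (ρ : ℝ) :
    IntegrableOn (fun w : ℂ => (w - η)⁻¹) (Metric.ball c ρ) := by
  have key : ∀ R : ℝ, IntegrableOn (fun w : ℂ => ‖w‖⁻¹) (Metric.ball 0 R) := by
    intro R
    rw [integrableOn_fun_norm_addHaar volume (f := fun x => x⁻¹)]
    simp only [Complex.finrank_real_complex]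
    refine (integrableOn_const (C := (1 : ℝ)) (by simp) (by simp)).congr_fun
      (fun x hx => ?_) measurableSet_Ioo
    have : x ≠ 0 := hx.1.ne'
    simp [this]
  obtain ⟨R, hR⟩ : ∃ R, Metric.ball c ρ ⊆ Metric.ball η R :=
    ⟨ρ + dist c η, fun x hx => by
      rw [Metric.mem_ball] at *
      linarith [dist_triangle x c η]⟩
  refine IntegrableOn.mono_set ?_ hR
  have h2 : IntegrableOn (fun w : ℂ => w⁻¹) (Metric.ball 0 R) := by
    refine (key R).mono' (measurable_inv.aestronglyMeasurable) ?_
    simp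
  have h3 := (measurePreserving_sub_right (volume : Measure ℂ) η).integrableOn_comp_preimage
    (MeasurableEquiv.subRight η).measurableEmbedding (f := fun w : ℂ => w⁻¹)
    (s := Metric.ball 0 R) |>.2 h2
  have h4 : (fun x : ℂ => x - η) ⁻¹' Metric.ball 0 R = Metric.ball η R := by
    ext x
    simp [dist_eq_norm]
  rw [h4] at h3
  exact h3

/-- For `η` outside the circle this is the mean value property. For `η` inside, `1/(z (z - η))` has
opposite residues at `0` and `η`, or a double pole without residue when `η = 0`. The excluded radius
is a null set in the later integration. -/
theorem circleAverage_inv_sub {η : ℂ} {s : ℝ} (hs : 0 < s) (hne : s ≠ ‖η‖) :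
    Real.circleAverage (fun w => (w - η)⁻¹) 0 s = if s < ‖η‖ then -η⁻¹ else 0 := by
  split_ifs with h
  · have : DiffContOnCl ℂ (fun w => (w - η)⁻¹) (Metric.ball 0 |s|) := by
      refine (DifferentiableOn.diffContOnCl fun w hw => ?_)
      have hw' : ‖w‖ ≤ s := by
        have := Metric.closure_ball_subset_closedBall hw
        simpa [abs_of_pos hs] using this
      have : w - η ≠ 0 := fun h0 => by
        rw [sub_eq_zero] at h0
        subst h0
        linarith
      exact ((differentiableAt_id.sub_const η).inv this).differentiableWithinAt
    rw [this.circleAverage]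
    simp [inv_neg]
  · have h : ‖η‖ < s := lt_of_le_of_ne (not_lt.1 h) (Ne.symm hne)
    rw [Real.circleAverage_eq_circleIntegral hs.ne']
    have h1 : (∮ z in C(0, s), ((z - 0)⁻¹ • (z - η)⁻¹ : ℂ)) = 0 := by
      have hη : η = 0 ∨ η ≠ 0 := eq_or_ne _ _
      rcases hη with rfl | hη
      · have := circleIntegral.integral_sub_zpow_of_ne (n := -2) (by decide) 0 (0 : ℂ) s
        refine Eq.trans (circleIntegral.integral_congr hs.le fun z _ => ?_) this
        rw [zpow_neg, show (2 : ℤ) = ((2 : ℕ) : ℤ) from rfl, zpow_natCast, sq, mul_inv, smul_eq_mul]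
      · have hc : ∀ a : ℂ, ‖a‖ < s → CircleIntegrable (fun z => (z - a)⁻¹) 0 s := by
          intro a ha
          rw [circleIntegrable_sub_inv_iff]
          right
          simp [abs_of_pos hs, ha.ne]
        have e : Set.EqOn (fun z : ℂ => (z - 0)⁻¹ • (z - η)⁻¹)
            (fun z => η⁻¹ * ((z - η)⁻¹ - (z - 0)⁻¹)) (Metric.sphere 0 s) := by
          intro z hz
          have hz : ‖z‖ = s := by simpa using hz
          have hz0 : z ≠ 0 := by
            rintro rfl
            simp at hz
            exact hs.ne hz
          have hz1 : z - η ≠ 0 := fun h0 => by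
            rw [sub_eq_zero] at h0
            subst h0
            exact hne hz.symm
          simp only [sub_zero, smul_eq_mul]
          field_simp
          ring
        rw [circleIntegral.integral_congr hs.le e, circleIntegral.integral_const_mul,
          circleIntegral.integral_sub (hc _ h) (hc 0 (by simpa using hs)),
          circleIntegral.integral_sub_inv_of_mem_ball (by simpa using h),
          circleIntegral.integral_sub_inv_of_mem_ball (by simpa using hs)]
        simp
    rw [h1, smul_zero]

/-- The Cauchy transform of a disc, inside the disc. -/
theorem setIntegral_ball_inv_sub {c ξ : ℂ} {ρ : ℝ} (hξ : ξ ∈ Metric.ball c ρ) :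
    ∫ w in Metric.ball c ρ, (w - ξ)⁻¹ = -Real.pi * (starRingEnd ℂ) (ξ - c) := by
  have hshift : ∫ w in Metric.ball c ρ, (w - ξ)⁻¹ =
      ∫ w in Metric.ball 0 ρ, (w - (ξ - c))⁻¹ := by
    have := (measurePreserving_sub_right (volume : Measure ℂ) c).setIntegral_preimage_emb
      (MeasurableEquiv.subRight c).measurableEmbedding (fun w => (w - (ξ - c))⁻¹)
      (Metric.ball 0 ρ)
    rw [← this]
    congr 1
    · congr 1
      ext x
      simp [dist_eq_norm]
    · ext x
      congr 1
      ring
  rw [hshift]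
  set η := ξ - c with hη
  have hη' : ‖η‖ < ρ := by simpa [hη, dist_eq_norm] using hξ
  rw [setIntegral_ball_eq_integral_circleAverage (integrableOn_inv_sub_ball _ _ _)]
  have hae : ∀ᵐ s : ℝ, s ∈ Set.Ioo 0 ρ → (2 * Real.pi * s) •
      Real.circleAverage (fun w => (w - η)⁻¹) 0 s =
      (Set.Ioo 0 ‖η‖).indicator (fun s : ℝ => ((2 * Real.pi * s : ℝ) : ℂ) * (-η⁻¹)) s := by
    have : ∀ᵐ s : ℝ, s ≠ ‖η‖ := by simp [ae_iff]
    filter_upwards [this] with s hs hs'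
    rw [circleAverage_inv_sub hs'.1 hs]
    by_cases h : s < ‖η‖
    · rw [if_pos h, Set.indicator_of_mem (show s ∈ Set.Ioo 0 ‖η‖ from ⟨hs'.1, h⟩)]
      simp
    · rw [if_neg h, Set.indicator_of_notMem (fun h' : s ∈ Set.Ioo 0 ‖η‖ => h h'.2)]
      simp
  rw [setIntegral_congr_ae measurableSet_Ioo hae, setIntegral_indicator measurableSet_Ioo,
    Set.inter_eq_right.2 (Set.Ioo_subset_Ioo_right hη'.le), integral_mul_const,
    integral_complex_ofReal,
    ← integral_Ioc_eq_integral_Ioo, ← intervalIntegral.integral_of_le (norm_nonneg _),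
    intervalIntegral.integral_const_mul, integral_id]
  by_cases h0 : η = 0
  · simp [h0]
  · have : (starRingEnd ℂ) η = (‖η‖ : ℂ) ^ 2 / η := by
      rw [← Complex.conj_mul' η]; field_simp
    rw [this]
    push_cast
    field_simp
    ring

/-! ### The exponential change of variables -/

theorem abs_det_toSpanSingleton_restrictScalars (a : ℂ) :
    |(((ContinuousLinearMap.toSpanSingleton ℂ a).restrictScalars ℝ : ℂ →L[ℝ] ℂ)).det| =
      ‖a‖ ^ 2 := by
  simp [ContinuousLinearMap.det, LinearMap.det_restrictScalars,
      Algebra.norm_complex_eq, Complex.normSq_eq_norm_sq]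

theorem hasFDerivAt_const_mul_exp (w₀ ζ : ℂ) :
    HasFDerivAt (fun ζ => w₀ * Complex.exp ζ)
      ((ContinuousLinearMap.toSpanSingleton ℂ (w₀ * Complex.exp ζ)).restrictScalars ℝ) ζ :=
  (((Complex.hasDerivAt_exp ζ).const_mul w₀).hasFDerivAt).restrictScalars ℝ

/-- Exponential change of variables for the measure `|w|⁻² dA`. -/
theorem setIntegral_image_const_mul_exp {w₀ : ℂ} (hw₀ : w₀ ≠ 0) {S : Set ℂ} (hS : MeasurableSet S)
    (hinj : Set.InjOn (fun ζ => w₀ * Complex.exp ζ) S) (g : ℂ → ℂ) :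
    ∫ w in (fun ζ => w₀ * Complex.exp ζ) '' S, g w / ((‖w‖ ^ 2 : ℝ) : ℂ) =
      ∫ ζ in S, g (w₀ * Complex.exp ζ) := by
  rw [integral_image_eq_integral_abs_det_fderiv_smul volume hS
    (fun ζ _ => (hasFDerivAt_const_mul_exp w₀ ζ).hasFDerivWithinAt) hinj]
  refine setIntegral_congr_fun hS fun ζ _ => ?_
  rw [abs_det_toSpanSingleton_restrictScalars, Complex.real_smul]
  have : ((‖w₀ * Complex.exp ζ‖ ^ 2 : ℝ) : ℂ) ≠ 0 := by
    exact_mod_cast (pow_pos (norm_pos_iff.2 (mul_ne_zero hw₀ (Complex.exp_ne_zero _))) 2).ne'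
  rw [mul_div_cancel₀ _ this]

/-! ### Regularity of integrals depending on a parameter -/

theorem setIntegral_ball_norm_inv {δ : ℝ} (hδ : 0 < δ) :
    ∫ u in Metric.ball (0 : ℂ) δ, ‖u‖⁻¹ = 2 * Real.pi * δ := by
  have hint : IntegrableOn (fun u : ℂ => ((‖u‖⁻¹ : ℝ) : ℂ)) (Metric.ball 0 δ) := by
    have := (integrableOn_inv_sub_ball 0 0 δ).norm.ofReal (𝕜 := ℂ)
    simpa [IntegrableOn] using this
  have h := setIntegral_ball_eq_integral_circleAverage hint
  rw [integral_complex_ofReal] at h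
  have h2 : ∀ s ∈ Set.Ioo 0 δ, (2 * Real.pi * s) •
      Real.circleAverage (fun u : ℂ => ((‖u‖⁻¹ : ℝ) : ℂ)) 0 s = ((2 * Real.pi : ℝ) : ℂ) := by
    intro s hs
    have : Real.circleAverage (fun u : ℂ => ((‖u‖⁻¹ : ℝ) : ℂ)) 0 s = ((s⁻¹ : ℝ) : ℂ) := by
      rw [Real.circleAverage_congr_sphere (f₂ := fun _ => ((s⁻¹ : ℝ) : ℂ)), Real.circleAverage_const]
      intro z hz
      simp only [mem_sphere_iff_norm, sub_zero, abs_of_pos hs.1] at hz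
      simp [hz]
    rw [this, Complex.real_smul, ← Complex.ofReal_mul, mul_assoc, mul_inv_cancel₀ hs.1.ne', mul_one]
  rw [setIntegral_congr_fun measurableSet_Ioo h2, setIntegral_const] at h
  simp only [Measure.real, Real.volume_Ioo, sub_zero, ENNReal.toReal_ofReal hδ.le,
    Complex.real_smul, ← Complex.ofReal_mul] at h
  rw [Complex.ofReal_injective h]
  ring

theorem integrableOn_div_sub {Ω : Set ℂ} (hb : Bornology.IsBounded Ω) (hm : MeasurableSet Ω)
    {φ : ℂ → ℂ} (hφ : AEStronglyMeasurable φ (volume.restrict Ω)) {M : ℝ}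
    (hM : ∀ w ∈ Ω, ‖φ w‖ ≤ M) (z : ℂ) : IntegrableOn (fun w => φ w / (w - z)) Ω := by
  obtain ⟨R, hR⟩ := hb.subset_ball 0
  have h1 : IntegrableOn (fun w => (w - z)⁻¹) Ω := (integrableOn_inv_sub_ball z 0 R).mono_set hR
  simp only [div_eq_mul_inv]
  refine h1.bdd_mul hφ (c := M) ?_
  exact (ae_restrict_iff' hm).2 (Eventually.of_forall hM)

/-- The Cauchy transform of a bounded function on a bounded set is continuous. -/
theorem continuous_integral_div_sub {Ω : Set ℂ} (hb : Bornology.IsBounded Ω)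
    (hm : MeasurableSet Ω) {φ : ℂ → ℂ} (hφ : AEStronglyMeasurable φ (volume.restrict Ω)) {M : ℝ}
    (hM : ∀ w ∈ Ω, ‖φ w‖ ≤ M) : Continuous fun z => ∫ w in Ω, φ w / (w - z) := by
  have hM0 : 0 ≤ |M| := abs_nonneg M
  have hM' : ∀ w ∈ Ω, ‖φ w‖ ≤ |M| := fun w hw => (hM w hw).trans (le_abs_self M)
  -- A bounded continuous truncation of `1/u`, equal to it for `‖u‖ ≥ δ`. The error is at most
  -- `1/‖u‖` on the `δ`-ball, so it costs `O(δ)` uniformly in `z`, and the Cauchy transform is a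
  -- uniform limit of continuous functions.
  let k : ℝ → ℂ → ℂ := fun δ u => (starRingEnd ℂ) u / (((max ‖u‖ δ) ^ 2 : ℝ) : ℂ)
  have hkc : ∀ δ > 0, Continuous (k δ) := by
    intro δ hδ
    refine Continuous.div (by fun_prop) (by fun_prop) fun u => ?_
    have : 0 < max ‖u‖ δ := lt_max_of_lt_right hδ
    exact_mod_cast (pow_pos this 2).ne'
  have hkb : ∀ δ > 0, ∀ u, ‖k δ u‖ ≤ δ⁻¹ := by
    intro δ hδ u
    have h0 : 0 < max ‖u‖ δ := lt_max_of_lt_right hδ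
    simp only [k, norm_div, RCLike.norm_conj, Complex.norm_real, norm_pow, Real.norm_eq_abs,
      abs_of_pos h0]
    rw [div_le_iff₀ (by positivity), inv_mul_eq_div, le_div_iff₀ hδ, sq]
    exact mul_le_mul (le_max_left _ _) (le_max_right _ _) hδ.le h0.le
  have hkd : ∀ δ > 0, ∀ u, ‖u⁻¹ - k δ u‖ ≤ (Metric.ball (0 : ℂ) δ).indicator (fun u => ‖u‖⁻¹) u := by
    intro δ hδ u
    by_cases h : ‖u‖ < δ
    · rw [Set.indicator_of_mem (by simpa using h)]
      have h0 : max ‖u‖ δ = δ := max_eq_right h.le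
      simp only [k, h0]
      rcases eq_or_ne u 0 with rfl | hu
      · simp
      have e : u⁻¹ - (starRingEnd ℂ) u / ((δ ^ 2 : ℝ) : ℂ) =
          u⁻¹ * ((1 - ‖u‖ ^ 2 / δ ^ 2 : ℝ) : ℂ) := by
        push_cast
        rw [← Complex.mul_conj' u]
        field_simp
      rw [e, norm_mul, norm_inv, Complex.norm_real]
      refine mul_le_of_le_one_right (by positivity) ?_
      have h1 : ‖u‖ ^ 2 / δ ^ 2 ≤ 1 := by
        rw [div_le_one (by positivity)]
        exact pow_le_pow_left₀ (norm_nonneg _) h.le 2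
      have h2 : 0 ≤ ‖u‖ ^ 2 / δ ^ 2 := by positivity
      rw [Real.norm_eq_abs, abs_le]
      constructor <;> linarith
    · rw [Set.indicator_of_notMem (by simpa using h)]
      have h0 : max ‖u‖ δ = ‖u‖ := max_eq_left (not_lt.1 h)
      simp only [k, h0]
      have hu : u ≠ 0 := by
        rintro rfl
        simp at h
        linarith
      rw [norm_le_zero_iff, sub_eq_zero]
      push_cast
      rw [← Complex.mul_conj' u]
      have : (starRingEnd ℂ) u ≠ 0 := by simpa using hu
      field_simp
  have hfin : IsFiniteMeasure (volume.restrict Ω) := ⟨by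
    rw [Measure.restrict_apply_univ]; exact hb.measure_lt_top⟩
  have hmeas : ∀ δ > 0, ∀ z, AEStronglyMeasurable (fun w => φ w * k δ (w - z))
      (volume.restrict Ω) := fun δ hδ z =>
    hφ.mul ((hkc δ hδ).comp (by fun_prop : Continuous fun w : ℂ => w - z)).aestronglyMeasurable
  have hbd : ∀ δ > 0, ∀ z, ∀ᵐ w ∂(volume.restrict Ω), ‖φ w * k δ (w - z)‖ ≤ |M| * δ⁻¹ := by
    intro δ hδ z
    refine (ae_restrict_iff' hm).2 (Eventually.of_forall fun w hw => ?_)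
    rw [norm_mul]
    exact mul_le_mul (hM' w hw) (hkb δ hδ _) (norm_nonneg _) hM0
  have hcont : ∀ δ > 0, Continuous fun z => ∫ w in Ω, φ w * k δ (w - z) := by
    intro δ hδ
    refine continuous_of_dominated (bound := fun _ => |M| * δ⁻¹) (hmeas δ hδ) (hbd δ hδ)
      (integrable_const _) (Eventually.of_forall fun w => ?_)
    exact continuous_const.mul ((hkc δ hδ).comp (by fun_prop))
  have hest : ∀ δ > 0, ∀ z, ‖(∫ w in Ω, φ w / (w - z)) - ∫ w in Ω, φ w * k δ (w - z)‖ ≤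
      |M| * (2 * Real.pi * δ) := by
    intro δ hδ z
    have hi2 : IntegrableOn (fun w => φ w * k δ (w - z)) Ω :=
      (integrable_const (|M| * δ⁻¹)).mono' (hmeas δ hδ z) (hbd δ hδ z)
    rw [← integral_sub (integrableOn_div_sub hb hm hφ hM z) hi2]
    have hI : Integrable (fun w : ℂ => (Metric.ball (0 : ℂ) δ).indicator (fun u => ‖u‖⁻¹) w) := by
      rw [integrable_indicator_iff Metric.isOpen_ball.measurableSet]
      simpa [IntegrableOn] using (integrableOn_inv_sub_ball 0 0 δ).norm
    have hI2 : Integrable (fun w : ℂ => |M| *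
        (Metric.ball (0 : ℂ) δ).indicator (fun u => ‖u‖⁻¹) (w - z)) :=
      (hI.comp_sub_right z).const_mul _
    calc _ ≤ ∫ w in Ω, |M| * (Metric.ball (0 : ℂ) δ).indicator (fun u => ‖u‖⁻¹) (w - z) := by
          refine norm_integral_le_of_norm_le hI2.integrableOn ?_
          refine (ae_restrict_iff' hm).2 (Eventually.of_forall fun w hw => ?_)
          rw [div_eq_mul_inv, ← mul_sub, norm_mul]
          exact mul_le_mul (hM' w hw) (hkd δ hδ _) (norm_nonneg _) hM0
      _ ≤ ∫ w, |M| * (Metric.ball (0 : ℂ) δ).indicator (fun u => ‖u‖⁻¹) (w - z) := by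
          refine setIntegral_le_integral hI2 (Eventually.of_forall fun w => ?_)
          refine mul_nonneg hM0 (Set.indicator_nonneg (fun u _ => by positivity) _)
      _ = |M| * (2 * Real.pi * δ) := by
          rw [integral_const_mul, integral_sub_right_eq_self
            (fun w : ℂ => (Metric.ball (0 : ℂ) δ).indicator (fun u => ‖u‖⁻¹) w),
            integral_indicator Metric.isOpen_ball.measurableSet, setIntegral_ball_norm_inv hδ]
  have hunif : TendstoUniformly (fun δ z => ∫ w in Ω, φ w * k δ (w - z))
      (fun z => ∫ w in Ω, φ w / (w - z)) (𝓝[>] (0 : ℝ)) := by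
    rw [Metric.tendstoUniformly_iff]
    intro ε hε
    have : Tendsto (fun δ : ℝ => |M| * (2 * Real.pi * δ)) (𝓝[>] 0) (𝓝 0) := by
      have : Continuous fun δ : ℝ => |M| * (2 * Real.pi * δ) := by fun_prop
      simpa using (this.tendsto 0).mono_left nhdsWithin_le_nhds
    filter_upwards [this.eventually_lt_const hε, self_mem_nhdsWithin] with δ hδ hδ0 z
    rw [dist_eq_norm]
    exact (hest δ hδ0 z).trans_lt hδ
  refine hunif.continuous (Eventually.frequently ?_)
  filter_upwards [self_mem_nhdsWithin] with δ hδ using hcont δ hδ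

/-- Holomorphy of an integral depending on a parameter, for bounded kernels. -/
theorem differentiableOn_setIntegral_of_bounded {U S : Set ℂ} (hU : IsOpen U)
    (hS : MeasurableSet S) (hSf : volume S < ⊤) {K : ℂ → ℂ → ℂ} {M : ℝ}
    (hmeas : ∀ z ∈ U, AEStronglyMeasurable (K z) (volume.restrict S))
    (hdiff : ∀ w ∈ S, DifferentiableOn ℂ (fun z => K z w) U)
    (hbound : ∀ w ∈ S, ∀ z ∈ U, ‖K z w‖ ≤ M) :
    DifferentiableOn ℂ (fun z => ∫ w in S, K z w) U := by
  intro z₀ hz₀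
  obtain ⟨ε, hε, hball⟩ := Metric.isOpen_iff.1 hU z₀ hz₀
  have hfin : IsFiniteMeasure (volume.restrict S) := ⟨by rwa [Measure.restrict_apply_univ]⟩
  have hder : ∀ w ∈ S, ∀ z ∈ U, HasDerivAt (fun z => K z w) (deriv (fun z => K z w) z) z :=
    fun w hw z hz => ((hdiff w hw).differentiableAt (hU.mem_nhds hz)).hasDerivAt
  -- Cauchy's estimate provides the dominating constant: discs of radius `ε/4` about these points
  -- stay in the `ε`-ball.
  have hcau : ∀ w ∈ S, ∀ z ∈ Metric.ball z₀ (ε / 2), ‖deriv (fun z => K z w) z‖ ≤ M / (ε / 4) := by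
    intro w hw z hz
    have hsub : Metric.closedBall z (ε / 4) ⊆ U := fun x hx => hball (by
      rw [Metric.mem_ball] at *
      rw [Metric.mem_closedBall] at hx
      linarith [dist_triangle x z z₀])
    refine Complex.norm_deriv_le_of_forall_mem_sphere_norm_le (by positivity) ?_ fun x hx =>
      hbound w hw x (hsub (Metric.sphere_subset_closedBall hx))
    exact ((hdiff w hw).mono (Metric.closure_ball_subset_closedBall.trans hsub)).diffContOnCl
  -- The derivative is measurable in `w` as a limit of difference quotients along a sequence.
  have hmeas' : AEStronglyMeasurable (fun w => deriv (fun z => K z w) z₀) (volume.restrict S) := by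
    have hseq : ∃ u : ℕ → ℂ, (∀ n, u n ∈ U ∧ u n ≠ z₀) ∧ Tendsto u atTop (𝓝 z₀) := by
      refine ⟨fun n => z₀ + ((ε / 2 / (n + 1) : ℝ) : ℂ), fun n => ⟨hball ?_, ?_⟩, ?_⟩
      · have h1 : 0 < ε / 2 / ((n : ℝ) + 1) := by positivity
        have h2 : ε / 2 / ((n : ℝ) + 1) ≤ ε / 2 :=
          div_le_self (by positivity) (by linarith [(Nat.cast_nonneg n : (0 : ℝ) ≤ n)])
        rw [Metric.mem_ball, dist_eq_norm, add_sub_cancel_left, Complex.norm_real,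
          Real.norm_eq_abs, abs_of_pos h1]
        linarith
      · have h1 : 0 < ε / 2 / ((n : ℝ) + 1) := by positivity
        simp only [ne_eq, add_eq_left]
        exact_mod_cast h1.ne'
      · have : Tendsto (fun n : ℕ => ε / 2 / ((n : ℝ) + 1)) atTop (𝓝 0) := by
          have := tendsto_one_div_add_atTop_nhds_zero_nat (𝕜 := ℝ) |>.const_mul (ε / 2)
          simpa [div_eq_mul_inv] using this
        have h2 := (Complex.continuous_ofReal.tendsto 0).comp this
        have h3 := h2.const_add z₀
        rw [Complex.ofReal_zero, add_zero] at h3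
        exact h3
    obtain ⟨u, hu, hut⟩ := hseq
    refine aestronglyMeasurable_of_tendsto_ae atTop
      (f := fun n w => (u n - z₀)⁻¹ • (K (u n) w - K z₀ w))
      (fun n => ((hmeas _ (hu n).1).sub (hmeas _ hz₀)).const_smul (u n - z₀)⁻¹) ?_
    refine (ae_restrict_iff' hS).2 (Eventually.of_forall fun w hw => ?_)
    have := (hasDerivAt_iff_tendsto_slope.1 (hder w hw z₀ hz₀)).comp
      (tendsto_nhdsWithin_iff.2 ⟨hut, Eventually.of_forall fun n => (hu n).2⟩)
    simpa [slope, Function.comp_def] using this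
  have hae : ∀ {p : ℂ → Prop}, (∀ w ∈ S, p w) → ∀ᵐ w ∂(volume.restrict S), p w :=
    fun h => (ae_restrict_iff' hS).2 (Eventually.of_forall h)
  have := hasDerivAt_integral_of_dominated_loc_of_deriv_le (μ := volume.restrict S)
    (F := K) (F' := fun z w => deriv (fun z => K z w) z) (x₀ := z₀)
    (s := Metric.ball z₀ (ε / 2)) (bound := fun _ => M / (ε / 4))
    (Metric.ball_mem_nhds _ (by positivity))
    (by filter_upwards [hU.mem_nhds hz₀] with z hz using hmeas z hz)
    ((integrable_const M).mono' (hmeas z₀ hz₀) (hae fun w hw => hbound w hw z₀ hz₀))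
    hmeas' (hae fun w hw z hz => hcau w hw z hz) (integrable_const _)
    (hae fun w hw z hz => hder w hw z (hball (Metric.ball_subset_ball (by linarith) hz)))
  exact this.2.differentiableAt.differentiableWithinAt

/-! ### The kernel `1/(exp u - 1)` -/

theorem dslope_exp_ne_zero {u : ℂ} (hu : ‖u‖ < 2 * Real.pi) : dslope Complex.exp 0 u ≠ 0 := by
  rcases eq_or_ne u 0 with rfl | h
  · simp
  · rw [dslope_of_ne _ h, slope_def_field, sub_zero, Complex.exp_zero]
    refine div_ne_zero (fun h0 => ?_) h
    rw [sub_eq_zero, Complex.exp_eq_one_iff] at h0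
    obtain ⟨n, rfl⟩ := h0
    rw [norm_mul, norm_mul, norm_mul, Complex.norm_I, Complex.norm_real, Complex.norm_intCast,
      Real.norm_eq_abs, abs_of_pos Real.pi_pos, mul_one] at hu
    have hn : n ≠ 0 := by
      rintro rfl
      simp at h
    have h1 : (1 : ℝ) ≤ |(n : ℝ)| := by
      exact_mod_cast Int.one_le_abs hn
    have h2 : ‖(2 : ℂ)‖ = 2 := by simp
    rw [h2] at hu
    nlinarith [Real.pi_pos]

theorem differentiable_dslope {f : ℂ → ℂ} (hf : Differentiable ℂ f) (c : ℂ) :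
    Differentiable ℂ (dslope f c) := by
  rw [← differentiableOn_univ] at *
  exact (Complex.differentiableOn_dslope univ_mem).2 hf

theorem exp_sub_one_eq_mul_dslope (u : ℂ) : Complex.exp u - 1 = u * dslope Complex.exp 0 u := by
  have := sub_smul_dslope Complex.exp 0 u
  simpa using this.symm

/-- The regular part of `1 / (exp u - 1)` at the origin. -/
def expInvRegularPart (u : ℂ) : ℂ :=
  -(dslope (dslope Complex.exp 0) 0 u) / dslope Complex.exp 0 u

theorem differentiableOn_expInvRegularPart :
    DifferentiableOn ℂ expInvRegularPart (Metric.ball 0 (2 * Real.pi)) := by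
  have h1 := differentiable_dslope Complex.differentiable_exp 0
  refine DifferentiableOn.div (differentiable_dslope h1 0).neg.differentiableOn
    h1.differentiableOn fun u hu => dslope_exp_ne_zero (by simpa using hu)

theorem inv_exp_sub_one {u : ℂ} (h0 : u ≠ 0) (hu : ‖u‖ < 2 * Real.pi) :
    (Complex.exp u - 1)⁻¹ = u⁻¹ + expInvRegularPart u := by
  have h1 := sub_smul_dslope (dslope Complex.exp 0) 0 u
  have h2 : dslope Complex.exp 0 0 = 1 := by simp
  rw [h2, sub_zero, smul_eq_mul] at h1
  have h3 : dslope (dslope Complex.exp 0) 0 u = (dslope Complex.exp 0 u - 1) / u := by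
    rw [← h1]; field_simp
  have h4 := dslope_exp_ne_zero hu
  rw [exp_sub_one_eq_mul_dslope, expInvRegularPart, h3]
  field_simp
  ring

/-! ### The Cauchy transform in the logarithmic coordinate -/

/-- A continuous branch of the logarithm is locally injectively inverted by the exponential. -/
theorem exists_ball_image_const_mul_exp_subset {Ω : Set ℂ} (hΩ : IsOpen Ω) {w₀ : ℂ} (hw₀ : w₀ ≠ 0)
    {L : ℂ → ℂ} (hL : ContinuousOn L Ω) (hexp : ∀ w ∈ Ω, w₀ * Complex.exp (L w) = w) {p : ℂ}
    (hp : p ∈ Ω) : ∃ ρ > 0, ρ ≤ 1 / 2 ∧ ∀ ζ ∈ Metric.ball (L p) ρ,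
      w₀ * Complex.exp ζ ∈ Ω ∧ L (w₀ * Complex.exp ζ) = ζ := by
  have hc : ContinuousAt (fun ζ => w₀ * Complex.exp ζ) (L p) := by fun_prop
  have hLc : ContinuousAt L p := hL.continuousAt (hΩ.mem_nhds hp)
  have h1 : ∀ᶠ w in 𝓝 p, w ∈ Ω ∧ dist (L w) (L p) < 1 :=
    Filter.Eventually.and (hΩ.mem_nhds hp) (hLc (Metric.ball_mem_nhds _ one_pos))
  rw [ContinuousAt, hexp p hp] at hc
  obtain ⟨ρ, hρ, h2⟩ := Metric.eventually_nhds_iff_ball.1 (hc.eventually h1)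
  refine ⟨min ρ (1 / 2), by positivity, min_le_right _ _, fun ζ hζ => ?_⟩
  have hζ1 := h2 ζ (Metric.ball_subset_ball (min_le_left _ _) hζ)
  refine ⟨hζ1.1, ?_⟩
  have hζ2 : dist ζ (L p) < 1 / 2 := lt_of_lt_of_le hζ (min_le_right _ _)
  have h3 : Complex.exp (L (w₀ * Complex.exp ζ)) = Complex.exp ζ :=
    mul_left_cancel₀ hw₀ (hexp _ hζ1.1)
  obtain ⟨n, hn⟩ := Complex.exp_eq_exp_iff_exists_int.1 h3
  have h4 : dist (L (w₀ * Complex.exp ζ)) ζ < 2 := by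
    have := dist_triangle (L (w₀ * Complex.exp ζ)) (L p) ζ
    rw [dist_comm (L p) ζ] at this
    linarith [hζ1.2]
  -- Two logarithms of the same point differ by a multiple of `2πi`, and these two are less than `2`
  -- apart.
  have hn0 : n = 0 := by
    by_contra hn0
    have h1 : (1 : ℝ) ≤ |(n : ℝ)| := by exact_mod_cast Int.one_le_abs hn0
    rw [hn, dist_eq_norm, add_sub_cancel_left, norm_mul, norm_mul, norm_mul, Complex.norm_I,
      Complex.norm_real, Complex.norm_intCast,
      Real.norm_eq_abs, abs_of_pos Real.pi_pos, mul_one, show ‖(2 : ℂ)‖ = 2 by simp] at h4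
    nlinarith [Real.pi_gt_three]
  rw [hn, hn0]
  simp

theorem hasDerivAt_log_branch {Ω : Set ℂ} (hΩ : IsOpen Ω) {w₀ : ℂ} (hw₀ : w₀ ≠ 0)
    {L : ℂ → ℂ} (hL : ContinuousOn L Ω) (hexp : ∀ w ∈ Ω, w₀ * Complex.exp (L w) = w) {w : ℂ}
    (hw : w ∈ Ω) : HasDerivAt L w⁻¹ w := by
  have hne : w₀ * Complex.exp (L w) ≠ 0 := mul_ne_zero hw₀ (Complex.exp_ne_zero _)
  have h1 : HasDerivAt (fun ζ => w₀ * Complex.exp ζ) (w₀ * Complex.exp (L w)) (L w) :=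
    (Complex.hasDerivAt_exp _).const_mul w₀
  have h2 := HasDerivAt.of_local_left_inverse (hL.continuousAt (hΩ.mem_nhds hw)) h1 hne
    (by filter_upwards [hΩ.mem_nhds hw] with x hx using hexp x hx)
  rwa [hexp w hw] at h2

/-- In the logarithmic coordinate the Cauchy transform of `|w|⁻²` is antiholomorphic up to a
holomorphic function. -/
theorem differentiableOn_mul_integral_add_conj {Ω : Set ℂ} (hΩ : IsOpen Ω)
    (hb : Bornology.IsBounded Ω) {m : ℝ} (hm : 0 < m) (hΩm : ∀ w ∈ Ω, m ≤ ‖w‖) {w₀ : ℂ}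
    (hw₀ : w₀ ≠ 0) {L : ℂ → ℂ} (hL : ContinuousOn L Ω)
    (hexp : ∀ w ∈ Ω, w₀ * Complex.exp (L w) = w) :
    DifferentiableOn ℂ (fun z => z * (∫ w in Ω, (((‖w‖ ^ 2 : ℝ) : ℂ))⁻¹ / (w - z)) +
      Real.pi * (starRingEnd ℂ) (L z)) Ω := by
  intro p hp
  obtain ⟨ρ, hρ, hρ2, hB⟩ := exists_ball_image_const_mul_exp_subset hΩ hw₀ hL hexp hp
  set e : ℂ → ℂ := fun ζ => w₀ * Complex.exp ζ with he
  set B := Metric.ball (L p) ρ with hBdef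
  have hBm : MeasurableSet B := Metric.isOpen_ball.measurableSet
  have himage : e '' B = Ω ∩ L ⁻¹' B := by
    ext w
    constructor
    · rintro ⟨ζ, hζ, rfl⟩
      refine ⟨(hB ζ hζ).1, ?_⟩
      rw [Set.mem_preimage, (hB ζ hζ).2]
      exact hζ
    · rintro ⟨hw, hw2⟩
      exact ⟨L w, hw2, hexp w hw⟩
  have hopen : IsOpen (e '' B) := himage ▸ hL.isOpen_inter_preimage hΩ Metric.isOpen_ball
  have hsub : e '' B ⊆ Ω := himage ▸ Set.inter_subset_left
  have hinj : Set.InjOn e B := fun x hx y hy hxy => by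
    rw [← (hB x hx).2, ← (hB y hy).2]
    exact congrArg L hxy
  have hpB : p ∈ e '' B := ⟨L p, Metric.mem_ball_self hρ, hexp p hp⟩
  obtain ⟨ε, hε, hεB⟩ := Metric.isOpen_iff.1 hopen p hpB
  have hinvb : ∀ w ∈ Ω, ‖(((‖w‖ ^ 2 : ℝ) : ℂ))⁻¹‖ ≤ (m ^ 2)⁻¹ := by
    intro w hw
    rw [norm_inv, Complex.norm_real, norm_pow, norm_norm]
    exact inv_anti₀ (by positivity) (pow_le_pow_left₀ hm.le (hΩm w hw) 2)
  have hmeas : Measurable fun w : ℂ => (((‖w‖ ^ 2 : ℝ) : ℂ))⁻¹ := by fun_prop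
  have hint : ∀ z, IntegrableOn (fun w => (((‖w‖ ^ 2 : ℝ) : ℂ))⁻¹ / (w - z)) Ω := fun z =>
    integrableOn_div_sub hb hΩ.measurableSet hmeas.aestronglyMeasurable hinvb z
  have hΩfin : volume Ω < ⊤ := hb.measure_lt_top
  -- Away from a neighbourhood of `p` the Cauchy kernel is bounded and holomorphic in `z`; only the
  -- part over `e '' B` needs the new coordinate.
  have houter : DifferentiableOn ℂ
      (fun z => ∫ w in Ω \ e '' B, (((‖w‖ ^ 2 : ℝ) : ℂ))⁻¹ / (w - z)) (Metric.ball p (ε / 2)) := by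
    have hfar : ∀ w ∈ Ω \ e '' B, ∀ z ∈ Metric.ball p (ε / 2), ε / 2 ≤ ‖w - z‖ := by
      intro w hw z hz
      by_contra! h
      refine hw.2 (hεB ?_)
      rw [Metric.mem_ball] at *
      rw [← dist_eq_norm] at h
      linarith [dist_triangle w z p]
    refine differentiableOn_setIntegral_of_bounded (M := (m ^ 2)⁻¹ / (ε / 2)) Metric.isOpen_ball
      (hΩ.measurableSet.diff hopen.measurableSet)
      ((measure_mono Set.sdiff_subset).trans_lt hΩfin) (fun z _ => ?_) (fun w hw z hz => ?_)
      (fun w hw z hz => ?_)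
    · exact (hmeas.div (by fun_prop)).aestronglyMeasurable
    · have hne : w - z ≠ 0 := norm_pos_iff.1 (lt_of_lt_of_le (by positivity) (hfar w hw z hz))
      exact ((differentiableAt_const _).div ((differentiableAt_const _).sub differentiableAt_id)
        hne).differentiableWithinAt
    · rw [norm_div]
      exact div_le_div₀ (by positivity) (hinvb w hw.1) (by positivity) (hfar w hw z hz)
  have hsmall : ∀ ζ ∈ B, ∀ ξ ∈ B, ‖ζ - ξ‖ ≤ 1 := by
    intro ζ hζ ξ hξ
    rw [← dist_eq_norm]
    have := dist_triangle_right ζ ξ (L p)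
    rw [hBdef, Metric.mem_ball] at hζ hξ
    linarith
  have hpi : (1 : ℝ) < 2 * Real.pi := by linarith [Real.pi_gt_three]
  have hEc : ContinuousOn expInvRegularPart (Metric.closedBall 0 1) :=
    differentiableOn_expInvRegularPart.continuousOn.mono (Metric.closedBall_subset_ball hpi)
  obtain ⟨C, hC⟩ := (isCompact_closedBall (0 : ℂ) 1).exists_bound_of_continuousOn hEc
  have hEcont : ∀ ξ ∈ B, ContinuousOn (fun ζ => expInvRegularPart (ζ - ξ)) B := fun ξ hξ =>
    hEc.comp (by fun_prop) fun ζ hζ => by simpa using hsmall ζ hζ ξ hξ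
  have hinner : DifferentiableOn ℂ (fun ξ => ∫ ζ in B, expInvRegularPart (ζ - ξ)) B := by
    refine differentiableOn_setIntegral_of_bounded (M := C) Metric.isOpen_ball hBm
      Metric.isBounded_ball.measure_lt_top
      (fun ξ hξ => (hEcont ξ hξ).aestronglyMeasurable hBm) (fun ζ hζ => ?_) (fun ζ hζ ξ hξ => ?_)
    · refine differentiableOn_expInvRegularPart.comp
        ((differentiableOn_const _).sub differentiableOn_id) fun ξ hξ => ?_
      rw [mem_ball_zero_iff]
      exact (hsmall ζ hζ ξ hξ).trans_lt hpi
    · exact hC _ (by simpa using hsmall ζ hζ ξ hξ)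
  have hLd : DifferentiableAt ℂ L p :=
    (hasDerivAt_log_branch hΩ hw₀ hL hexp hp).differentiableAt
  -- The singular part of the kernel contributes `-π conj (L z - L p)`, so adding `π conj (L z)`
  -- leaves only the constant `π conj (L p)`.
  have hmain : DifferentiableAt ℂ (fun z => z * (∫ w in Ω \ e '' B,
      (((‖w‖ ^ 2 : ℝ) : ℂ))⁻¹ / (w - z)) + (∫ ζ in B, expInvRegularPart (ζ - L z)) +
      Real.pi * (starRingEnd ℂ) (L p)) p := by
    refine ((differentiableAt_id.mul (houter.differentiableAt
      (Metric.ball_mem_nhds _ (by positivity)))).add ?_).add_const _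
    exact (hinner.differentiableAt (Metric.ball_mem_nhds _ hρ)).comp p hLd
  refine (hmain.congr_of_eventuallyEq ?_).differentiableWithinAt
  filter_upwards [hopen.mem_nhds hpB] with z hz
  have hLz : L z ∈ B := by
    rw [himage] at hz
    exact hz.2
  have hzexp : w₀ * Complex.exp (L z) = z := hexp z (hsub hz)
  have hz0 : z ≠ 0 := by
    rw [← hzexp]
    exact mul_ne_zero hw₀ (Complex.exp_ne_zero _)
  have hsplit : ∫ w in Ω, (((‖w‖ ^ 2 : ℝ) : ℂ))⁻¹ / (w - z) =
      (∫ w in Ω \ e '' B, (((‖w‖ ^ 2 : ℝ) : ℂ))⁻¹ / (w - z)) +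
      ∫ w in e '' B, (((‖w‖ ^ 2 : ℝ) : ℂ))⁻¹ / (w - z) := by
    rw [← setIntegral_union Set.disjoint_sdiff_left hopen.measurableSet
      ((hint z).mono_set Set.sdiff_subset) ((hint z).mono_set hsub), Set.sdiff_union_of_subset hsub]
  have hchange : z * ∫ w in e '' B, (((‖w‖ ^ 2 : ℝ) : ℂ))⁻¹ / (w - z) =
      ∫ ζ in B, ((ζ - L z)⁻¹ + expInvRegularPart (ζ - L z)) := by
    have h1 : ∀ w, (((‖w‖ ^ 2 : ℝ) : ℂ))⁻¹ / (w - z) = (w - z)⁻¹ / ((‖w‖ ^ 2 : ℝ) : ℂ) := by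
      intro w
      rw [div_eq_mul_inv, div_eq_mul_inv, mul_comm]
    simp_rw [h1]
    rw [setIntegral_image_const_mul_exp hw₀ hBm hinj (fun w => (w - z)⁻¹), ← integral_const_mul]
    refine setIntegral_congr_ae hBm ?_
    have : ∀ᵐ ζ : ℂ, ζ ≠ L z := by simp [ae_iff]
    filter_upwards [this] with ζ hne hζ
    rw [← inv_exp_sub_one (sub_ne_zero.2 hne) ((hsmall ζ hζ _ hLz).trans_lt hpi)]
    have h2 : w₀ * Complex.exp ζ - z = z * (Complex.exp (ζ - L z) - 1) := by
      have h3 : Complex.exp ζ = Complex.exp (L z) * Complex.exp (ζ - L z) := by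
        rw [← Complex.exp_add, add_sub_cancel]
      rw [h3, ← mul_assoc, hzexp, mul_sub, mul_one]
    rw [h2, mul_inv, ← mul_assoc, mul_inv_cancel₀ hz0, one_mul]
  have hint2 : IntegrableOn (fun ζ => expInvRegularPart (ζ - L z)) B := by
    have hfin : IsFiniteMeasure (volume.restrict B) := ⟨by
      rw [Measure.restrict_apply_univ]; exact Metric.isBounded_ball.measure_lt_top⟩
    refine (integrable_const C).mono' ((hEcont _ hLz).aestronglyMeasurable hBm) ?_
    exact (ae_restrict_iff' hBm).2 (Eventually.of_forall fun ζ hζ =>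
      hC _ (by simpa using hsmall ζ hζ _ hLz))
  rw [hsplit, mul_add, hchange, integral_add (integrableOn_inv_sub_ball _ _ _) hint2,
    setIntegral_ball_inv_sub hLz, map_sub]
  ring

/-! ### Consequences of the quadrature identity -/

theorem simplePole_num_denom {α : ℂ} (hα : α ≠ 0) (w₀ : ℂ) :
    (RatFunc.C α / (RatFunc.X - RatFunc.C w₀) : RatFunc ℂ).num = Polynomial.C α ∧
    (RatFunc.C α / (RatFunc.X - RatFunc.C w₀) : RatFunc ℂ).denom =
      Polynomial.X - Polynomial.C w₀ := by
  have hq : (Polynomial.X - Polynomial.C w₀ : Polynomial ℂ) ≠ 0 := Polynomial.X_sub_C_ne_zero w₀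
  have e : (RatFunc.C α / (RatFunc.X - RatFunc.C w₀) : RatFunc ℂ) =
      algebraMap _ _ (Polynomial.C α) / algebraMap _ _ (Polynomial.X - Polynomial.C w₀) := by
    simp
  set h := (RatFunc.C α / (RatFunc.X - RatFunc.C w₀) : RatFunc ℂ) with hh
  have h1 : h.num * (Polynomial.X - Polynomial.C w₀) = Polynomial.C α * h.denom :=
    (RatFunc.num_mul_eq_mul_denom_iff hq).2 e
  have h2 : h.denom ∣ Polynomial.X - Polynomial.C w₀ := by
    rw [e]
    exact RatFunc.denom_div_dvd _ _
  have h3 : (Polynomial.X - Polynomial.C w₀) ∣ h.denom := by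
    have : (Polynomial.X - Polynomial.C w₀) ∣ Polynomial.C α * h.denom := ⟨h.num, by
      rw [← h1, mul_comm]⟩
    exact ((Polynomial.isUnit_C.2 hα.isUnit).dvd_mul_left).1 this
  have h4 : h.denom = Polynomial.X - Polynomial.C w₀ :=
    Polynomial.eq_of_monic_of_associated (RatFunc.monic_denom h) (Polynomial.monic_X_sub_C w₀)
      (associated_of_dvd_dvd h2 h3)
  refine ⟨?_, h4⟩
  rw [h4] at h1
  exact mul_right_cancel₀ hq h1

theorem eval_simplePole {α : ℂ} (hα : α ≠ 0) (w₀ w : ℂ) :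
    (RatFunc.C α / (RatFunc.X - RatFunc.C w₀) : RatFunc ℂ).eval (RingHom.id ℂ) w =
      α / (w - w₀) := by
  rw [RatFunc.eval, (simplePole_num_denom hα w₀).1, (simplePole_num_denom hα w₀).2]
  simp

/-- The Lipschitz constant bounds the derivative on the open interval, and the endpoints are null.
-/
theorem intervalIntegrable_mul_deriv_of_lipschitzOnWith {γ : ℝ → ℂ} {K : NNReal}
    (hγ : LipschitzOnWith K γ (Set.Icc 0 1)) {g : ℂ → ℂ}
    (hg : ContinuousOn g (γ '' Set.Icc 0 1)) :
    IntervalIntegrable (fun t => g (γ t) * deriv γ t) volume 0 1 := by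
  have hgc : ContinuousOn (fun t => g (γ t)) (Set.Icc 0 1) :=
    hg.comp hγ.continuousOn (Set.mapsTo_image _ _)
  have hgi : IntegrableOn (fun t => g (γ t)) (Set.Ioo 0 1) :=
    (hgc.integrableOn_compact isCompact_Icc).mono_set Set.Ioo_subset_Icc_self
  rw [intervalIntegrable_iff_integrableOn_Ioo_of_le zero_le_one]
  refine Integrable.mul_bdd (c := K) hgi (measurable_deriv γ).aestronglyMeasurable ?_
  refine (ae_restrict_iff' measurableSet_Ioo).2 (Eventually.of_forall fun t ht => ?_)
  exact norm_deriv_le_of_lipschitzOn (Icc_mem_nhds ht.1 ht.2) hγ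

theorem IsBoundaryCycle.contour_linear_combination {n : ℕ} {γ : Fin n → ℝ → ℂ} {Ω : Set ℂ}
    (h : IsBoundaryCycle γ Ω) {g₁ g₂ : ℂ → ℂ} (h₁ : ContinuousOn g₁ (frontier Ω))
    (h₂ : ContinuousOn g₂ (frontier Ω)) (a b : ℂ) {g : ℂ → ℂ}
    (hg : ∀ w ∈ frontier Ω, g w = a * g₁ w + b * g₂ w) :
    cycleContourIntegral γ g = a * cycleContourIntegral γ g₁ + b * cycleContourIntegral γ g₂ := by
  simp only [cycleContourIntegral, Finset.mul_sum, ← Finset.sum_add_distrib]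
  refine Finset.sum_congr rfl fun i _ => ?_
  have hsub : γ i '' Set.Icc 0 1 ⊆ frontier Ω := h.image_eq ▸ Set.subset_iUnion_of_subset i le_rfl
  obtain ⟨K, hK⟩ := h.lipschitz i
  have i1 := intervalIntegrable_mul_deriv_of_lipschitzOnWith hK (h₁.mono hsub)
  have i2 := intervalIntegrable_mul_deriv_of_lipschitzOnWith hK (h₂.mono hsub)
  have e : ∫ t in (0 : ℝ)..1, g (γ i t) * deriv (γ i) t =
      ∫ t in (0 : ℝ)..1, (a * (g₁ (γ i t) * deriv (γ i) t) + b * (g₂ (γ i t) * deriv (γ i) t)) := by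
    refine intervalIntegral.integral_congr fun t ht => ?_
    rw [Set.uIcc_of_le zero_le_one] at ht
    simp only [hg _ (hsub ⟨t, ht, rfl⟩)]
    ring
  simp only [curveContourIntegral]
  rw [e, intervalIntegral.integral_add (i1.const_mul a) (i2.const_mul b),
    intervalIntegral.integral_const_mul, intervalIntegral.integral_const_mul]
  ring

theorem exists_pos_le_norm_of_zero_notMem {Ω : Set ℂ} (h0 : (0 : ℂ) ∉ closure Ω) :
    ∃ m > 0, ∀ w ∈ Ω, m ≤ ‖w‖ := by
  rw [Metric.mem_closure_iff] at h0
  push Not at h0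
  obtain ⟨m, hm, h⟩ := h0
  exact ⟨m, hm, fun w hw => by simpa using h w hw⟩

theorem zero_notMem_closure {Ω : Set ℂ} (h0 : (0 : ℂ) ∉ Ω) (h1 : (0 : ℂ) ∉ frontier Ω) :
    (0 : ℂ) ∉ closure Ω := by
  rw [closure_eq_self_union_frontier]
  exact fun h => h.elim h0 h1

theorem norm_inv_ofReal_sq_norm_le {m : ℝ} (hm : 0 < m) {w : ℂ} (hw : m ≤ ‖w‖) :
    ‖(((‖w‖ ^ 2 : ℝ) : ℂ))⁻¹‖ ≤ (m ^ 2)⁻¹ := by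
  rw [norm_inv, Complex.norm_real, norm_pow, norm_norm]
  exact inv_anti₀ (by positivity) (pow_le_pow_left₀ hm.le hw 2)

theorem mem_of_isBoundedLQD_simplePole {α w₀ : ℂ} (hα : α ≠ 0) {Ω : Set ℂ}
    (h : IsBoundedLQD Ω (RatFunc.C α / (RatFunc.X - RatFunc.C w₀))) : w₀ ∈ Ω :=
  h.isRatZero.poles w₀ (by rw [(simplePole_num_denom hα w₀).2]; simp)

/-- The test function is `1`; the contour side is `α` times the winding number about `w₀`. This is
what makes `α` real and positive. -/
theorem IsBoundedLQD.integral_weight {α w₀ : ℂ} (hα : α ≠ 0) {Ω : Set ℂ}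
    (h : IsBoundedLQD Ω (RatFunc.C α / (RatFunc.X - RatFunc.C w₀))) (h0 : (0 : ℂ) ∉ Ω) :
    (Real.pi : ℂ)⁻¹ * ∫ w in Ω, (((‖w‖ ^ 2 : ℝ) : ℂ))⁻¹ = α := by
  have hw₀ := mem_of_isBoundedLQD_simplePole hα h
  obtain ⟨m, hm, hΩm⟩ := exists_pos_le_norm_of_zero_notMem
    (zero_notMem_closure h0 h.zero_notMem_frontier)
  obtain ⟨n, γ, hγ, hq⟩ := h.quadrature
  have hfin : IsFiniteMeasure (volume.restrict Ω) := ⟨by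
    rw [Measure.restrict_apply_univ]; exact h.isBounded.measure_lt_top⟩
  have htest : IsLogTestFunction Ω (fun _ => 1) := by
    refine ⟨diffContOnCl_const, ?_⟩
    simp only [one_div]
    refine (integrable_const ((m ^ 2)⁻¹)).mono' (Measurable.aestronglyMeasurable (by fun_prop)) ?_
    exact (ae_restrict_iff' h.isOpen.measurableSet).2 (Eventually.of_forall fun w hw =>
      norm_inv_ofReal_sq_norm_le hm (hΩm w hw))
  have h1 := hq _ htest
  simp only [one_div] at h1
  rw [h1]
  have hc : ContinuousOn (fun w => 1 / (w - w₀)) (frontier Ω) := by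
    refine ContinuousOn.div (by fun_prop) (by fun_prop) fun w hw h2 => ?_
    rw [sub_eq_zero.1 h2, h.isOpen.frontier_eq] at hw
    exact hw.2 hw₀
  rw [hγ.contour_linear_combination hc hc α 0 (fun w _ => by rw [eval_simplePole hα]; ring)]
  have := hγ.winding_interior w₀ hw₀
  rw [cycleWindingNumber] at this
  rw [this]
  ring

/-- The test function is `1/(w - z)`. Partial fractions split the contour integrand into simple
poles at `w₀` and `z`, with winding numbers `1` and `0`. -/
theorem IsBoundedLQD.cauchyTransform_eq {α w₀ : ℂ} (hα : α ≠ 0) {Ω : Set ℂ}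
    (h : IsBoundedLQD Ω (RatFunc.C α / (RatFunc.X - RatFunc.C w₀))) (h0 : (0 : ℂ) ∉ Ω)
    {z : ℂ} (hz : z ∉ closure Ω) :
    (Real.pi : ℂ)⁻¹ * ∫ w in Ω, (((‖w‖ ^ 2 : ℝ) : ℂ))⁻¹ / (w - z) = α / (w₀ - z) := by
  have hw₀ := mem_of_isBoundedLQD_simplePole hα h
  obtain ⟨m, hm, hΩm⟩ := exists_pos_le_norm_of_zero_notMem
    (zero_notMem_closure h0 h.zero_notMem_frontier)
  obtain ⟨n, γ, hγ, hq⟩ := h.quadrature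
  have hne : ∀ w ∈ closure Ω, w - z ≠ 0 := fun w hw h2 => hz (sub_eq_zero.1 h2 ▸ hw)
  have e : ∀ w : ℂ, (w - z)⁻¹ / ((‖w‖ ^ 2 : ℝ) : ℂ) = (((‖w‖ ^ 2 : ℝ) : ℂ))⁻¹ / (w - z) := by
    intro w
    rw [div_eq_mul_inv, div_eq_mul_inv, mul_comm]
  have htest : IsLogTestFunction Ω (fun w => (w - z)⁻¹) := by
    refine ⟨((differentiable_id.diffContOnCl).sub_const z).inv hne, ?_⟩
    simp_rw [e]
    exact integrableOn_div_sub h.isBounded h.isOpen.measurableSet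
      (Measurable.aestronglyMeasurable (by fun_prop))
      (fun w hw => norm_inv_ofReal_sq_norm_le hm (hΩm w hw)) z
  have h1 := hq _ htest
  simp_rw [e] at h1
  rw [h1]
  have hwne : ∀ w ∈ frontier Ω, w - w₀ ≠ 0 := fun w hw h2 => by
    rw [sub_eq_zero.1 h2, h.isOpen.frontier_eq] at hw
    exact hw.2 hw₀
  have hc : ContinuousOn (fun w => 1 / (w - w₀)) (frontier Ω) :=
    ContinuousOn.div (by fun_prop) (by fun_prop) hwne
  have hc2 : ContinuousOn (fun w => 1 / (w - z)) (frontier Ω) :=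
    ContinuousOn.div (by fun_prop) (by fun_prop) fun w hw => hne w (frontier_subset_closure hw)
  have hz0 : w₀ - z ≠ 0 := hne _ (subset_closure hw₀)
  rw [hγ.contour_linear_combination hc hc2 (α / (w₀ - z)) (-(α / (w₀ - z))) (fun w hw => by
    rw [eval_simplePole hα]
    have h3 := hwne w hw
    have h4 := hne w (frontier_subset_closure hw)
    field_simp
    ring)]
  have h5 := hγ.winding_interior w₀ hw₀
  have h6 := hγ.winding_exterior z hz
  rw [cycleWindingNumber] at h5 h6
  rw [h5, h6]
  ring

/-- The identity for the Cauchy transform extends to all points off the domain. -/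
theorem IsBoundedLQD.cauchyTransform_eq_of_notMem {α w₀ : ℂ} (hα : α ≠ 0) {Ω : Set ℂ}
    (h : IsBoundedLQD Ω (RatFunc.C α / (RatFunc.X - RatFunc.C w₀))) (h0 : (0 : ℂ) ∉ Ω)
    {z : ℂ} (hz : z ∉ Ω) :
    (w₀ - z) * ((Real.pi : ℂ)⁻¹ * ∫ w in Ω, (((‖w‖ ^ 2 : ℝ) : ℂ))⁻¹ / (w - z)) = α := by
  obtain ⟨m, hm, hΩm⟩ := exists_pos_le_norm_of_zero_notMem
    (zero_notMem_closure h0 h.zero_notMem_frontier)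
  have hcont : Continuous fun z => ∫ w in Ω, (((‖w‖ ^ 2 : ℝ) : ℂ))⁻¹ / (w - z) :=
    continuous_integral_div_sub h.isBounded h.isOpen.measurableSet
      (Measurable.aestronglyMeasurable (by fun_prop))
      (fun w hw => norm_inv_ofReal_sq_norm_le hm (hΩm w hw))
  have hclosed : IsClosed {z | (w₀ - z) *
      ((Real.pi : ℂ)⁻¹ * ∫ w in Ω, (((‖w‖ ^ 2 : ℝ) : ℂ))⁻¹ / (w - z)) = α} :=
    isClosed_eq (by fun_prop) continuous_const
  have hsub : (closure Ω)ᶜ ⊆ {z | (w₀ - z) *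
      ((Real.pi : ℂ)⁻¹ * ∫ w in Ω, (((‖w‖ ^ 2 : ℝ) : ℂ))⁻¹ / (w - z)) = α} := by
    intro z hz
    have hne : w₀ - z ≠ 0 := fun h2 =>
      hz (sub_eq_zero.1 h2 ▸ subset_closure (mem_of_isBoundedLQD_simplePole hα h))
    rw [Set.mem_ofPred_eq, h.cauchyTransform_eq hα h0 hz, mul_div_cancel₀ _ hne]
  -- The condition `Ω = int (cl Ω)` says exactly that the exterior is dense in the complement of
  -- `Ω`.
  have hz2 : z ∈ closure (closure Ω)ᶜ := by
    rw [closure_compl, h.interior_closure]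
    exact hz
  exact hclosed.closure_subset_iff.2 hsub hz2

/-! ### Rigidity: the domain is a disc in the logarithmic coordinate -/

/-- Maximum principle for functions that are asymptotically bounded by `C` at the ideal boundary. -/
theorem norm_le_of_forall_exists_compact {Ω : Set ℂ} (hΩ : IsOpen Ω) (hc : IsPreconnected Ω)
    {f : ℂ → ℂ} (hf : DifferentiableOn ℂ f Ω) {C : ℝ}
    (h : ∀ δ > 0, ∃ K ⊆ Ω, IsCompact K ∧ ∀ w ∈ Ω, w ∉ K → ‖f w‖ ≤ C + δ) {p : ℂ} (hp : p ∈ Ω) :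
    ‖f p‖ ≤ C := by
  by_contra! hlt
  obtain ⟨K, hKΩ, hK, hb⟩ := h ((‖f p‖ - C) / 2) (by linarith)
  have hpK : p ∈ K := by
    by_contra hpK
    linarith [hb p hp hpK]
  obtain ⟨c, hcK, hmax⟩ := hK.exists_isMaxOn ⟨p, hpK⟩ (hf.continuousOn.mono hKΩ).norm
  have hcp : ‖f p‖ ≤ ‖f c‖ := hmax hpK
  have hmaxΩ : IsMaxOn (norm ∘ f) Ω c := by
    intro w hw
    by_cases hwK : w ∈ K
    · exact hmax hwK
    · change ‖f w‖ ≤ ‖f c‖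
      linarith [hb w hw hwK]
  have hconst := Complex.norm_eqOn_of_isPreconnected_of_isMaxOn hc hΩ hf (hKΩ hcK) hmaxΩ
  -- An interior maximum makes `‖f‖` constant, above the bound valid off `K`. So `Ω` would be
  -- compact as well as open and nonempty.
  have hΩK : Ω = K := by
    refine Set.Subset.antisymm (fun w hw => ?_) hKΩ
    by_contra hwK
    have h1 : ‖f w‖ = ‖f c‖ := hconst hw
    linarith [hb w hw hwK]
  have hclopen : IsClopen Ω := ⟨hΩK ▸ hK.isClosed, hΩ⟩
  have huniv := hclopen.eq_univ ⟨p, hp⟩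
  exact noncompact_univ ℂ (huniv ▸ hΩK ▸ hK)

/-- A bounded domain on which the function `(w₀ - z) * T z - a` vanishes off the domain and
`z * T z + conj (L z)` is holomorphic, `L` being a branch of `log (z / w₀)`, corresponds
to a disc in the logarithmic coordinate. -/
theorem image_log_branch_eq_ball {Ω : Set ℂ} (hΩ : IsOpen Ω) (hc : IsPreconnected Ω)
    (hb : Bornology.IsBounded Ω) {w₀ : ℂ} (hw₀ : w₀ ≠ 0) (hmem : w₀ ∈ Ω) {L : ℂ → ℂ}
    (hL : ContinuousOn L Ω) (hexp : ∀ w ∈ Ω, w₀ * Complex.exp (L w) = w) (hL0 : L w₀ = 0)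
    {M : ℝ} (hre : ∀ w ∈ Ω, |(L w).re| ≤ M) {a : ℝ} (ha : 0 < a) {T : ℂ → ℂ} (hT : Continuous T)
    (hT0 : ∀ z ∉ Ω, (w₀ - z) * T z = a)
    (hTd : DifferentiableOn ℂ (fun z => z * T z + (starRingEnd ℂ) (L z)) Ω) :
    L '' Ω = Metric.ball 0 (Real.sqrt a) := by
  have hM : 0 ≤ M := (abs_nonneg _).trans (hre w₀ hmem)
  have hLd : DifferentiableOn ℂ L Ω := fun w hw =>
    (hasDerivAt_log_branch hΩ hw₀ hL hexp hw).differentiableAt.differentiableWithinAt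
  set D : ℂ → ℂ := fun z => (w₀ - z) * T z - a with hD
  have hDc : Continuous D := by fun_prop
  have hD0 : ∀ z ∉ Ω, D z = 0 := fun z hz => by simp [hD, hT0 z hz]
  -- the compact sets off which the potential gradient is small
  set K : ℝ → Set ℂ := fun η => {z | η * ‖w₀ - z‖ ≤ ‖z * D z‖} with hK
  have hKΩ : ∀ η > 0, K η ⊆ Ω := by
    intro η hη z hz
    by_contra hzΩ
    have h1 : η * ‖w₀ - z‖ ≤ ‖z * D z‖ := hz
    rw [hD0 z hzΩ, mul_zero, norm_zero] at h1
    have h2 : 0 < ‖w₀ - z‖ := norm_pos_iff.2 fun h => hzΩ (sub_eq_zero.1 h ▸ hmem)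
    nlinarith
  have hKc : ∀ η > 0, IsCompact (K η) := fun η hη =>
    Metric.isCompact_of_isClosed_isBounded (isClosed_le (by fun_prop) (by fun_prop))
      (hb.subset (hKΩ η hη))
  -- Replacing `T` by its exterior value `a/(w₀ - z)` would turn this into `|L|²`; `dslope` is `L/(z
  -- - w₀)` with the singularity at `w₀` removed.
  set H : ℂ → ℂ := fun z => L z * (z * T z + (starRingEnd ℂ) (L z)) + a * z * dslope L w₀ z with hH
  have hHd : DifferentiableOn ℂ H Ω := by
    refine (hLd.mul hTd).add (((differentiableOn_const _).mul differentiableOn_id).mul ?_)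
    exact (Complex.differentiableOn_dslope (hΩ.mem_nhds hmem)).2 hLd
  have hHw₀ : H w₀ = a := by
    simp only [hH, hL0, zero_mul, zero_add, dslope_same,
      (hasDerivAt_log_branch hΩ hw₀ hL hexp hmem).deriv]
    field_simp
  have hHeq : ∀ z, z ≠ w₀ → (w₀ - z) * (H z - (‖L z‖ : ℂ) ^ 2) = L z * (z * D z) := by
    intro z hz
    have h1 : z - w₀ ≠ 0 := sub_ne_zero.2 hz
    have h2 : (z - w₀) * dslope L w₀ z = L z := by
      have := sub_smul_dslope L w₀ z
      rwa [hL0, sub_zero, smul_eq_mul] at this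
    rw [← Complex.mul_conj', hD, hH]
    linear_combination -(a : ℂ) * z * h2
  have hsmall : ∀ η, ∀ z, z ∉ K η → z ≠ w₀ ∧ ‖H z - (‖L z‖ : ℂ) ^ 2‖ ≤ η * ‖L z‖ := by
    intro η z hz
    have h1 : ‖z * D z‖ < η * ‖w₀ - z‖ := not_le.1 hz
    have hne : z ≠ w₀ := by
      rintro rfl
      rw [sub_self, norm_zero, mul_zero] at h1
      exact absurd h1 (not_lt.2 (norm_nonneg _))
    refine ⟨hne, ?_⟩
    have h2 : 0 < ‖w₀ - z‖ := norm_pos_iff.2 (sub_ne_zero.2 hne.symm)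
    have h3 := congrArg norm (hHeq z hne)
    rw [norm_mul, norm_mul (L z)] at h3
    have h4 : ‖L z‖ * ‖z * D z‖ ≤ ‖L z‖ * (η * ‖w₀ - z‖) :=
      mul_le_mul_of_nonneg_left h1.le (norm_nonneg _)
    refine le_of_mul_le_mul_left ?_ h2
    linarith
  -- `Re L` is bounded but no bound on `Im L` is available yet, so smallness relative to `|L|` is
  -- not smallness. The barrier `1 + M² - L²` has real part at least `1 + (Im L)²`, which beats the
  -- linear growth of `|L|`; its coefficient `ε` then tends to `0`.
  have him : ∀ s : ℝ, (s = 1 ∨ s = -1) → ∀ z ∈ Ω, s * (H z).im ≤ 0 := by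
    intro s hs z hz
    have key : ∀ ε > 0, s * (H z).im ≤ ε * (1 + M ^ 2 - (L z).re ^ 2 + (L z).im ^ 2) := by
      intro ε hε
      set f : ℂ → ℂ := fun z => Complex.exp (-(Complex.I * s * H z) -
        ε * (1 + M ^ 2 - L z ^ 2)) with hf
      have hfd : DifferentiableOn ℂ f Ω := by
        refine DifferentiableOn.cexp (((hHd.const_mul _).neg).sub (DifferentiableOn.const_mul ?_ _))
        exact (hLd.pow 2).const_sub _
      have hfn : ∀ z, ‖f z‖ = Real.exp (s * (H z).im -
          ε * (1 + M ^ 2 - (L z).re ^ 2 + (L z).im ^ 2)) := by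
        intro z
        rw [hf, Complex.norm_exp]
        congr 1
        have e1 : (Complex.I * (s : ℂ) * H z).re = -(s * (H z).im) := by
          simp [Complex.mul_re]
        have e2 : ((ε : ℂ) * (1 + (M : ℂ) ^ 2 - L z ^ 2)).re =
            ε * (1 + M ^ 2 - (L z).re ^ 2 + (L z).im ^ 2) := by
          rw [Complex.re_ofReal_mul, Complex.sub_re, Complex.add_re, ← Complex.ofReal_pow,
            Complex.ofReal_re, Complex.one_re, sq (L z), Complex.mul_re]
          ring
        rw [Complex.sub_re, Complex.neg_re, e1, e2]
        ring
      have hle : ‖f z‖ ≤ 1 := by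
        refine norm_le_of_forall_exists_compact hΩ hc hfd (fun δ hδ => ?_) hz
        have hη : 0 < ε / (M + 1) := by positivity
        refine ⟨K (ε / (M + 1)), hKΩ _ hη, hKc _ hη, fun w hw hwK => ?_⟩
        obtain ⟨-, h1⟩ := hsmall _ _ hwK
        have h2 : |(H w).im| ≤ ε / (M + 1) * ‖L w‖ := by
          refine le_trans ?_ h1
          have : (H w).im = (H w - (‖L w‖ : ℂ) ^ 2).im := by
            rw [← Complex.ofReal_pow, Complex.sub_im, Complex.ofReal_im, sub_zero]
          rw [this]
          exact Complex.abs_im_le_norm _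
        have h3 : ‖L w‖ ≤ M + |(L w).im| :=
          (Complex.norm_le_abs_re_add_abs_im _).trans (by linarith [hre w hw])
        have h4 : s * (H w).im ≤ |(H w).im| := by
          rcases hs with rfl | rfl
          · rw [one_mul]; exact le_abs_self _
          · rw [neg_one_mul]; exact neg_le_abs _
        have h5 : M + |(L w).im| ≤ (M + 1) * (1 + (L w).im ^ 2) := by
          have := sq_abs (L w).im
          nlinarith [sq_nonneg (|(L w).im| - 1), mul_nonneg hM (sq_nonneg (L w).im)]
        have h6 : ε / (M + 1) * ‖L w‖ ≤ ε * (1 + (L w).im ^ 2) := by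
          calc _ ≤ ε / (M + 1) * ((M + 1) * (1 + (L w).im ^ 2)) :=
                mul_le_mul_of_nonneg_left (h3.trans h5) hη.le
            _ = _ := by field_simp
        have h7 : (L w).re ^ 2 ≤ M ^ 2 := sq_le_sq' (by linarith [abs_le.1 (hre w hw)])
          (abs_le.1 (hre w hw)).2
        have h8 : ε * (1 + (L w).im ^ 2) ≤ ε * (1 + M ^ 2 - (L w).re ^ 2 + (L w).im ^ 2) :=
          mul_le_mul_of_nonneg_left (by linarith) hε.le
        have h9 : ‖f w‖ ≤ 1 := by
          rw [hfn, Real.exp_le_one_iff]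
          linarith
        linarith
      rw [hfn, Real.exp_le_one_iff] at hle
      linarith
    have hlim : Tendsto (fun ε : ℝ => ε * (1 + M ^ 2 - (L z).re ^ 2 + (L z).im ^ 2)) (𝓝[>] 0)
        (𝓝 0) := by
      have : Continuous fun ε : ℝ => ε * (1 + M ^ 2 - (L z).re ^ 2 + (L z).im ^ 2) := by fun_prop
      simpa using (this.tendsto 0).mono_left nhdsWithin_le_nhds
    refine ge_of_tendsto hlim ?_
    filter_upwards [self_mem_nhdsWithin] with ε hε using key ε hε
  have him0 : ∀ z ∈ Ω, (H z).im = 0 := fun z hz =>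
    le_antisymm (by simpa using him 1 (Or.inl rfl) z hz) (by simpa using him (-1) (Or.inr rfl) z hz)
  -- A real-valued holomorphic function cannot be open, so it is constant, with the value taken at
  -- `w₀`.
  have hHconst : ∀ z ∈ Ω, H z = a := by
    rcases (hHd.analyticOnNhd hΩ).is_constant_or_isOpen hc with ⟨v, hv⟩ | hop
    · intro z hz
      rw [hv z hz, ← hv w₀ hmem, hHw₀]
    · exfalso
      have h1 : IsOpen (H '' Ω) := hop Ω Set.Subset.rfl hΩ
      obtain ⟨ε, hε, hsub⟩ := Metric.isOpen_iff.1 h1 (H w₀) ⟨w₀, hmem, rfl⟩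
      obtain ⟨z, hz, hz2⟩ := hsub (show H w₀ + ((ε / 2 : ℝ) : ℂ) * Complex.I ∈ _ by
        rw [Metric.mem_ball, dist_eq_norm, add_sub_cancel_left, norm_mul, Complex.norm_I,
          Complex.norm_real, Real.norm_eq_abs, abs_of_pos (by positivity)]
        linarith)
      have h2 := congrArg Complex.im hz2
      rw [him0 z hz, Complex.add_im, him0 w₀ hmem, Complex.im_ofReal_mul, Complex.I_im] at h2
      linarith
  have hsa : 0 < Real.sqrt a := Real.sqrt_pos.2 ha
  have hsq : Real.sqrt a * Real.sqrt a = a := Real.mul_self_sqrt ha.le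
  -- Off `K δ` one has `‖L‖² ≤ a + δ ‖L‖`, hence `‖L‖ ≤ √a + δ`.
  have hle : ∀ w ∈ Ω, ‖L w‖ ≤ Real.sqrt a := by
    intro w hw
    refine norm_le_of_forall_exists_compact hΩ hc hLd (fun δ hδ => ?_) hw
    refine ⟨K δ, hKΩ _ hδ, hKc _ hδ, fun z hz hzK => ?_⟩
    obtain ⟨-, h1⟩ := hsmall _ _ hzK
    rw [hHconst z hz, ← Complex.ofReal_pow, ← Complex.ofReal_sub, Complex.norm_real,
      Real.norm_eq_abs] at h1
    have h2 := (abs_le.1 h1).1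
    by_contra! h3
    nlinarith
  have hlt : ∀ w ∈ Ω, ‖L w‖ < Real.sqrt a := by
    intro w hw
    refine lt_of_le_of_ne (hle w hw) fun heq => ?_
    have hmax : IsMaxOn (norm ∘ L) Ω w := fun z hz => by
      change ‖L z‖ ≤ ‖L w‖
      rw [heq]
      exact hle z hz
    have h1 : ‖L w₀‖ = ‖L w‖ :=
      Complex.norm_eqOn_of_isPreconnected_of_isMaxOn hc hΩ hLd hw hmax hmem
    rw [hL0, norm_zero, heq] at h1
    exact hsa.ne h1
  have hopen : IsOpen (L '' Ω) := by
    rw [Metric.isOpen_iff]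
    rintro _ ⟨p, hp, rfl⟩
    obtain ⟨ρ, hρ, -, hB⟩ := exists_ball_image_const_mul_exp_subset hΩ hw₀ hL hexp hp
    exact ⟨ρ, hρ, fun ζ hζ => ⟨_, (hB ζ hζ).1, (hB ζ hζ).2⟩⟩
  refine Set.Subset.antisymm ?_ ?_
  · rintro _ ⟨w, hw, rfl⟩
    simpa using hlt w hw
  -- The open image fills the connected disc once it is relatively closed there. The identity
  -- linking `|L|²` and `D`, written in `ζ`, passes to the closure; at a limit point `ζ` with `w₀ *
  -- exp ζ` off `Ω` it reads `|ζ|² = a`, impossible inside the disc.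
  refine (convex_ball (0 : ℂ) (Real.sqrt a)).isPreconnected.subset_of_closure_inter_subset hopen
    ⟨0, by simpa using hsa, w₀, hmem, hL0⟩ ?_
  rintro ζ ⟨hζ, hζa⟩
  have hclosed : IsClosed {ζ : ℂ | (w₀ - w₀ * Complex.exp ζ) * (a - (‖ζ‖ : ℂ) ^ 2) =
      ζ * (w₀ * Complex.exp ζ * D (w₀ * Complex.exp ζ))} :=
    isClosed_eq (by fun_prop) (by fun_prop)
  have hmemc : ζ ∈ {ζ : ℂ | (w₀ - w₀ * Complex.exp ζ) * (a - (‖ζ‖ : ℂ) ^ 2) =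
      ζ * (w₀ * Complex.exp ζ * D (w₀ * Complex.exp ζ))} := by
    refine hclosed.closure_subset_iff.2 ?_ hζ
    rintro _ ⟨w, hw, rfl⟩
    rw [Set.mem_ofPred_eq, hexp w hw]
    rcases eq_or_ne w w₀ with rfl | hne
    · simp [hL0]
    · rw [← hHeq w hne, hHconst w hw]
  by_cases hwΩ : w₀ * Complex.exp ζ ∈ Ω
  · refine ⟨_, hwΩ, ?_⟩
    have : (𝓝[L '' Ω] ζ).NeBot := mem_closure_iff_nhdsWithin_neBot.1 hζ
    have h1 : Tendsto (fun ζ => L (w₀ * Complex.exp ζ)) (𝓝[L '' Ω] ζ)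
        (𝓝 (L (w₀ * Complex.exp ζ))) := by
      have hc1 : ContinuousAt (fun ζ => w₀ * Complex.exp ζ) ζ := by fun_prop
      have hc2 : ContinuousAt L (w₀ * Complex.exp ζ) := hL.continuousAt (hΩ.mem_nhds hwΩ)
      exact (hc2.comp_of_eq hc1 rfl).tendsto.mono_left nhdsWithin_le_nhds
    refine tendsto_nhds_unique_of_eventuallyEq h1
      (tendsto_id.mono_left nhdsWithin_le_nhds : Tendsto id (𝓝[L '' Ω] ζ) (𝓝 ζ)) ?_
    filter_upwards [self_mem_nhdsWithin]
    rintro _ ⟨w, hw, rfl⟩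
    rw [hexp w hw, id]
  · exfalso
    rw [Set.mem_ofPred_eq, hD0 _ hwΩ, mul_zero, mul_zero] at hmemc
    rcases mul_eq_zero.1 hmemc with h1 | h1
    · exact hwΩ (sub_eq_zero.1 h1 ▸ hmem)
    · rw [sub_eq_zero] at h1
      have h2 : a = ‖ζ‖ ^ 2 := by exact_mod_cast h1
      rw [mem_ball_zero_iff] at hζa
      nlinarith [norm_nonneg ζ]

theorem IsBoundedLQD.eq_of_simplePole {α w₀ : ℂ} (hα : α ≠ 0) (hw₀ : w₀ ≠ 0) {Ω : Set ℂ}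
    (hsc : IsSimplyConnected Ω) (h0 : (0 : ℂ) ∉ Ω)
    (h : IsBoundedLQD Ω (RatFunc.C α / (RatFunc.X - RatFunc.C w₀))) :
    α.im = 0 ∧ 0 < α.re ∧ α.re ≤ Real.pi ^ 2 ∧
      Ω = (fun ζ => w₀ * Complex.exp ζ) '' Metric.ball 0 (Real.sqrt α.re) := by
  have hmem := mem_of_isBoundedLQD_simplePole hα h
  obtain ⟨m, hm, hΩm⟩ := exists_pos_le_norm_of_zero_notMem
    (zero_notMem_closure h0 h.zero_notMem_frontier)
  obtain ⟨R, hR⟩ := h.isBounded.exists_norm_le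
  have hα2 := h.integral_weight hα h0
  have hαre : α = ((Real.pi⁻¹ * ∫ w in Ω, (‖w‖ ^ 2)⁻¹ : ℝ) : ℂ) := by
    rw [← hα2]
    push_cast
    rw [← integral_complex_ofReal]
    push_cast
    rfl
  set a : ℝ := Real.pi⁻¹ * ∫ w in Ω, (‖w‖ ^ 2)⁻¹ with ha
  have ha0 : 0 < a := by
    refine lt_of_le_of_ne ?_ fun h1 => hα (by rw [hαre, ← h1]; simp)
    exact mul_nonneg (by positivity) (integral_nonneg fun w => by positivity)
  rw [hαre, Complex.ofReal_re, Complex.ofReal_im]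
  obtain ⟨L', hL', hexp'⟩ := Complex.exists_continuousOn_eqOn_exp_comp hsc h.isOpen
    (g := fun w => w / w₀) (by fun_prop) (by
      rintro ⟨w, hw, hw2⟩
      rcases div_eq_zero_iff.1 hw2 with rfl | h2
      · exact h0 hw
      · exact hw₀ h2)
  -- Normalised to vanish at `w₀`, so that the disc is centred at `0`.
  set L : ℂ → ℂ := fun w => L' w - L' w₀ with hLdef
  have hL : ContinuousOn L Ω := hL'.sub continuousOn_const
  have hL0 : L w₀ = 0 := sub_self _
  have hexp : ∀ w ∈ Ω, w₀ * Complex.exp (L w) = w := by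
    intro w hw
    have h1 : Complex.exp (L' w) = w / w₀ := hexp' hw
    have h2 : Complex.exp (L' w₀) = w₀ / w₀ := hexp' hmem
    rw [hLdef]
    simp only
    rw [Complex.exp_sub, h1, h2, div_self hw₀, div_one, mul_div_cancel₀ _ hw₀]
  have hnorm : ∀ w ∈ Ω, Real.exp (L w).re = ‖w‖ / ‖w₀‖ := by
    intro w hw
    have h1 := congrArg norm (hexp w hw)
    rw [norm_mul, Complex.norm_exp] at h1
    rw [← h1, mul_div_cancel_left₀ _ (norm_pos_iff.2 hw₀).ne']
  have hw₀n : 0 < ‖w₀‖ := norm_pos_iff.2 hw₀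
  have hre : ∀ w ∈ Ω, |(L w).re| ≤ max (Real.log (R / ‖w₀‖)) (-Real.log (m / ‖w₀‖)) := by
    intro w hw
    have h1 : (L w).re = Real.log (‖w‖ / ‖w₀‖) := by rw [← hnorm w hw, Real.log_exp]
    have hwp : 0 < ‖w‖ := hm.trans_le (hΩm w hw)
    rw [h1, abs_le']
    constructor
    · exact le_max_of_le_left (Real.log_le_log (by positivity)
        (div_le_div_of_nonneg_right (hR w hw) hw₀n.le))
    · exact le_max_of_le_right (neg_le_neg (Real.log_le_log (by positivity)
        (div_le_div_of_nonneg_right (hΩm w hw) hw₀n.le)))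
  set T : ℂ → ℂ := fun z => (Real.pi : ℂ)⁻¹ * ∫ w in Ω, (((‖w‖ ^ 2 : ℝ) : ℂ))⁻¹ / (w - z) with hTdef
  have hT : Continuous T := continuous_const.mul
    (continuous_integral_div_sub h.isBounded h.isOpen.measurableSet
      (Measurable.aestronglyMeasurable (by fun_prop))
      (fun w hw => norm_inv_ofReal_sq_norm_le hm (hΩm w hw)))
  have hTd : DifferentiableOn ℂ (fun z => z * T z + (starRingEnd ℂ) (L z)) Ω := by
    have h1 := (differentiableOn_mul_integral_add_conj h.isOpen h.isBounded hm hΩm hw₀ hL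
      hexp).const_mul (Real.pi : ℂ)⁻¹
    refine h1.congr fun z _ => ?_
    have : (Real.pi : ℂ) ≠ 0 := by exact_mod_cast Real.pi_ne_zero
    simp only [hTdef]
    field_simp
  have hball := image_log_branch_eq_ball h.isOpen h.isConnected.isPreconnected h.isBounded hw₀ hmem
    hL hexp hL0 hre ha0 hT (fun z hz => by
      rw [← hαre]
      exact h.cauchyTransform_eq_of_notMem hα h0 hz) hTd
  have hinv : ∀ ζ ∈ Metric.ball (0 : ℂ) (Real.sqrt a),
      w₀ * Complex.exp ζ ∈ Ω ∧ L (w₀ * Complex.exp ζ) = ζ := by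
    rw [← hball]
    rintro _ ⟨w, hw, rfl⟩
    rw [hexp w hw]
    exact ⟨hw, rfl⟩
  refine ⟨rfl, ha0, ?_, ?_⟩
  -- A disc of radius above `π` contains both `πi` and `-πi`, which `w₀ * exp` sends to `-w₀`; yet
  -- `L` inverts this map on the disc.
  · by_contra! hlt
    have h1 : Real.pi < Real.sqrt a := Real.lt_sqrt_of_sq_lt hlt
    have h2 := (hinv (Real.pi * Complex.I) (by simpa [abs_of_pos Real.pi_pos] using h1)).2
    have h3 := (hinv (-(Real.pi * Complex.I)) (by simpa [abs_of_pos Real.pi_pos] using h1)).2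
    rw [Complex.exp_neg, Complex.exp_pi_mul_I] at h3
    rw [Complex.exp_pi_mul_I] at h2
    norm_num at h2 h3
    rw [h2] at h3
    have h4 := congrArg Complex.im h3
    simp at h4
    linarith [Real.pi_pos]
  · ext w
    constructor
    · intro hw
      exact ⟨L w, hball ▸ Set.mem_image_of_mem L hw, hexp w hw⟩
    · rintro ⟨ζ, hζ, rfl⟩
      exact (hinv ζ hζ).1

/-! ### The principal logarithm and the topology of exponential images of discs -/

theorem norm_log_exp_eq {ζ : ℂ} (h : |ζ.im| ≤ Real.pi) : ‖Complex.log (Complex.exp ζ)‖ = ‖ζ‖ := by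
  rcases (abs_le.1 h).1.lt_or_eq with h1 | h1
  · rw [Complex.log_exp h1 (abs_le.1 h).2]
  -- On the line `Im ζ = -π` the principal logarithm returns the conjugate of `ζ`, which has the
  -- same norm.
  · have e : (starRingEnd ℂ) ζ = ζ + 2 * Real.pi * Complex.I := by
      apply Complex.ext
      · simp
      · simp [← h1]; ring
    have h2 : Complex.exp ζ = Complex.exp ((starRingEnd ℂ) ζ) := by
      rw [e, Complex.exp_periodic]
    rw [h2, Complex.log_exp (by simp [← h1, Real.pi_pos]) (by simp [← h1]), RCLike.norm_conj]

/-- The principal value keeps the real part and never increases the absolute value of the imaginary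
part. Hence the descriptions of the ball images need no bound on the radius, unlike that of the
sphere. -/
theorem norm_log_exp_le (ζ : ℂ) : ‖Complex.log (Complex.exp ζ)‖ ≤ ‖ζ‖ := by
  rcases le_total |ζ.im| Real.pi with h | h
  · exact (norm_log_exp_eq h).le
  · rw [← sq_le_sq₀ (norm_nonneg _) (norm_nonneg _), Complex.sq_norm, Complex.sq_norm,
      Complex.normSq_apply, Complex.normSq_apply, Complex.log_re, Complex.norm_exp, Real.log_exp]
    have h1 : |(Complex.log (Complex.exp ζ)).im| ≤ |ζ.im| := by
      rw [Complex.log_im]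
      exact (Complex.abs_arg_le_pi _).trans h
    nlinarith [sq_le_sq.2 h1]

theorem log_const_mul_exp_div {w₀ : ℂ} (hw₀ : w₀ ≠ 0) (ζ : ℂ) :
    Complex.log (w₀ * Complex.exp ζ / w₀) = Complex.log (Complex.exp ζ) := by
  rw [mul_div_cancel_left₀ _ hw₀]

theorem const_mul_exp_log_div {w₀ w : ℂ} (hw₀ : w₀ ≠ 0) (hw : w ≠ 0) :
    w₀ * Complex.exp (Complex.log (w / w₀)) = w := by
  rw [Complex.exp_log (div_ne_zero hw hw₀), mul_div_cancel₀ _ hw₀]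

theorem image_const_mul_exp_ball {w₀ : ℂ} (hw₀ : w₀ ≠ 0) (r : ℝ) :
    (fun ζ => w₀ * Complex.exp ζ) '' Metric.ball 0 r =
      {w : ℂ | w ≠ 0 ∧ ‖Complex.log (w / w₀)‖ < r} := by
  ext w
  constructor
  · rintro ⟨ζ, hζ, rfl⟩
    refine ⟨mul_ne_zero hw₀ (Complex.exp_ne_zero _), ?_⟩
    rw [log_const_mul_exp_div hw₀]
    exact (norm_log_exp_le ζ).trans_lt (by simpa using hζ)
  · rintro ⟨hw, h⟩
    exact ⟨_, by simpa using h, const_mul_exp_log_div hw₀ hw⟩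

theorem image_const_mul_exp_closedBall {w₀ : ℂ} (hw₀ : w₀ ≠ 0) (r : ℝ) :
    (fun ζ => w₀ * Complex.exp ζ) '' Metric.closedBall 0 r =
      {w : ℂ | w ≠ 0 ∧ ‖Complex.log (w / w₀)‖ ≤ r} := by
  ext w
  constructor
  · rintro ⟨ζ, hζ, rfl⟩
    refine ⟨mul_ne_zero hw₀ (Complex.exp_ne_zero _), ?_⟩
    rw [log_const_mul_exp_div hw₀]
    exact (norm_log_exp_le ζ).trans (by simpa using hζ)
  · rintro ⟨hw, h⟩
    exact ⟨_, by simpa using h, const_mul_exp_log_div hw₀ hw⟩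

theorem image_const_mul_exp_sphere {w₀ : ℂ} (hw₀ : w₀ ≠ 0) {r : ℝ} (hr : r ≤ Real.pi) :
    (fun ζ => w₀ * Complex.exp ζ) '' Metric.sphere 0 r =
      {w : ℂ | w ≠ 0 ∧ ‖Complex.log (w / w₀)‖ = r} := by
  ext w
  constructor
  · rintro ⟨ζ, hζ, rfl⟩
    have hζ : ‖ζ‖ = r := by simpa using hζ
    refine ⟨mul_ne_zero hw₀ (Complex.exp_ne_zero _), ?_⟩
    rw [log_const_mul_exp_div hw₀, norm_log_exp_eq, hζ]
    exact (Complex.abs_im_le_norm ζ).trans (hζ.le.trans hr)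
  · rintro ⟨hw, h⟩
    exact ⟨_, by simpa using h, const_mul_exp_log_div hw₀ hw⟩

theorem closure_image_const_mul_exp_ball {w₀ : ℂ} (hw₀ : w₀ ≠ 0) {r : ℝ} (hr : 0 < r) :
    closure ((fun ζ => w₀ * Complex.exp ζ) '' Metric.ball 0 r) =
      {w : ℂ | w ≠ 0 ∧ ‖Complex.log (w / w₀)‖ ≤ r} := by
  have hc : Continuous fun ζ => w₀ * Complex.exp ζ := by fun_prop
  rw [← image_const_mul_exp_closedBall hw₀]
  refine Set.Subset.antisymm ?_ ?_
  · exact closure_minimal (Set.image_mono Metric.ball_subset_closedBall)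
      ((isCompact_closedBall 0 r).image hc).isClosed
  · rw [← closure_ball (0 : ℂ) hr.ne']
    exact image_closure_subset_closure_image hc

theorem interior_closure_image_const_mul_exp_ball {w₀ : ℂ} (hw₀ : w₀ ≠ 0) {r : ℝ} (hr : 0 < r)
    (hopen : IsOpen ((fun ζ => w₀ * Complex.exp ζ) '' Metric.ball 0 r)) :
    interior (closure ((fun ζ => w₀ * Complex.exp ζ) '' Metric.ball 0 r)) =
      (fun ζ => w₀ * Complex.exp ζ) '' Metric.ball 0 r := by
  refine Set.Subset.antisymm (fun p hp => ?_) (interior_maximal subset_closure hopen)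
  have hp0 := interior_subset hp
  rw [closure_image_const_mul_exp_ball hw₀ hr] at hp hp0
  rw [image_const_mul_exp_ball hw₀]
  refine ⟨hp0.1, lt_of_le_of_ne hp0.2 fun heq => ?_⟩
  set ζ := Complex.log (p / w₀) with hζ
  -- Scaling `p` by a positive real moves only the real part of the logarithm, never across the
  -- branch cut. With this sign the norm increases strictly, so `p` is a limit of exterior points,
  -- even at the double point `-w₀` for `r = π`.
  obtain ⟨s, hs, hsζ⟩ : ∃ s : ℝ, (s = 1 ∨ s = -1) ∧ 0 ≤ s * ζ.re := by
    rcases le_total 0 ζ.re with h | h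
    · exact ⟨1, Or.inl rfl, by simpa using h⟩
    · exact ⟨-1, Or.inr rfl, by simpa using h⟩
  have hct : Tendsto (fun ε : ℝ => p * ((Real.exp (s * ε) : ℝ) : ℂ)) (𝓝[>] 0) (𝓝 p) := by
    have : Continuous fun ε : ℝ => p * ((Real.exp (s * ε) : ℝ) : ℂ) := by fun_prop
    simpa using (this.tendsto 0).mono_left nhdsWithin_le_nhds
  have hev := hct.eventually (mem_interior_iff_mem_nhds.1 hp)
  obtain ⟨ε, hε, hε0⟩ := (hev.and self_mem_nhdsWithin).exists
  have hε0 : 0 < ε := hε0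
  have hlog : Complex.log (p * ((Real.exp (s * ε) : ℝ) : ℂ) / w₀) = ((s * ε : ℝ) : ℂ) + ζ := by
    rw [mul_div_right_comm, mul_comm, Complex.log_ofReal_mul (Real.exp_pos _)
      (div_ne_zero hp0.1 hw₀), Real.log_exp]
  have h1 := hε.2
  rw [hlog, ← heq, ← sq_le_sq₀ (norm_nonneg _) (norm_nonneg _), Complex.sq_norm, Complex.sq_norm,
    Complex.normSq_apply, Complex.normSq_apply, Complex.add_re, Complex.add_im,
    Complex.ofReal_re, Complex.ofReal_im, zero_add] at h1
  have hs2 : s * s = 1 := by rcases hs with rfl | rfl <;> norm_num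
  nlinarith [mul_nonneg hsζ hε0.le, mul_pos hε0 hε0]

theorem frontier_image_const_mul_exp_ball {w₀ : ℂ} (hw₀ : w₀ ≠ 0) {r : ℝ} (hr : 0 < r)
    (hrpi : r ≤ Real.pi) (hopen : IsOpen ((fun ζ => w₀ * Complex.exp ζ) '' Metric.ball 0 r)) :
    frontier ((fun ζ => w₀ * Complex.exp ζ) '' Metric.ball 0 r) =
      (fun ζ => w₀ * Complex.exp ζ) '' Metric.sphere 0 r := by
  rw [hopen.frontier_eq, closure_image_const_mul_exp_ball hw₀ hr, image_const_mul_exp_ball hw₀,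
    image_const_mul_exp_sphere hw₀ hrpi]
  ext w
  constructor
  · rintro ⟨⟨h1, h2⟩, h3⟩
    exact ⟨h1, le_antisymm h2 (not_lt.1 fun h => h3 ⟨h1, h⟩)⟩
  · rintro ⟨h1, h2⟩
    exact ⟨⟨h1, h2.le⟩, fun h => h.2.ne h2⟩

theorem injOn_const_mul_exp_ball {w₀ : ℂ} (hw₀ : w₀ ≠ 0) {r : ℝ} (hrpi : r ≤ Real.pi) :
    Set.InjOn (fun ζ => w₀ * Complex.exp ζ) (Metric.ball 0 r) := by
  intro x hx y hy hxy
  have h : ∀ z ∈ Metric.ball (0 : ℂ) r, Complex.log (Complex.exp z) = z := by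
    intro z hz
    have h1 : |z.im| < Real.pi :=
      (Complex.abs_im_le_norm z).trans_lt ((by simpa using hz : ‖z‖ < r).trans_le hrpi)
    exact Complex.log_exp (abs_lt.1 h1).1 (abs_lt.1 h1).2.le
  rw [← h x hx, ← h y hy, mul_left_cancel₀ hw₀ hxy]

/-! ### The boundary curve and the converse direction -/

/-- The exponential image of a circle, as a curve on `[0, 1]`. -/
def expCircle (w₀ : ℂ) (r : ℝ) (t : ℝ) : ℂ :=
  w₀ * Complex.exp (circleMap 0 r (2 * Real.pi * t))

theorem hasDerivAt_expCircle (w₀ : ℂ) (r t : ℝ) :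
    HasDerivAt (expCircle w₀ r) (expCircle w₀ r t *
      (2 * Real.pi * deriv (circleMap 0 r) (2 * Real.pi * t))) t := by
  have h1 : HasDerivAt (fun t : ℝ => 2 * Real.pi * t) (2 * Real.pi) t := by
    simpa using (hasDerivAt_id t).const_mul (2 * Real.pi)
  have h2 : HasDerivAt (circleMap 0 r) (deriv (circleMap 0 r) (2 * Real.pi * t)) (2 * Real.pi * t) :=
    (differentiable_circleMap 0 r _).hasDerivAt
  have h3 := (h2.scomp t h1).cexp.const_mul w₀
  refine h3.congr_deriv ?_
  simp only [expCircle, Function.comp_apply, Complex.real_smul]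
  push_cast
  ring

theorem curveContourIntegral_expCircle (w₀ : ℂ) (r : ℝ) (g : ℂ → ℂ) :
    curveContourIntegral (expCircle w₀ r) g = (2 * (Real.pi : ℂ) * Complex.I)⁻¹ *
      ∮ ζ in C(0, r), g (w₀ * Complex.exp ζ) * (w₀ * Complex.exp ζ) := by
  rw [curveContourIntegral, circleIntegral]
  congr 1
  have h := intervalIntegral.smul_integral_comp_mul_left (a := 0) (b := 1)
    (fun θ => deriv (circleMap 0 r) θ •
      (g (w₀ * Complex.exp (circleMap 0 r θ)) * (w₀ * Complex.exp (circleMap 0 r θ))))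
    (2 * Real.pi)
  rw [mul_zero, mul_one] at h
  rw [← h, ← intervalIntegral.integral_smul]
  refine intervalIntegral.integral_congr fun t _ => ?_
  simp only [(hasDerivAt_expCircle w₀ r t).deriv, Complex.real_smul, smul_eq_mul, expCircle]
  push_cast
  ring

theorem lipschitzOnWith_expCircle (w₀ : ℂ) (r : ℝ) :
    ∃ K : NNReal, LipschitzOnWith K (expCircle w₀ r) (Set.Icc 0 1) := by
  have h : ContDiff ℝ 1 (expCircle w₀ r) := by
    unfold expCircle
    exact contDiff_const.mul (((contDiff_circleMap 0 r).comp (by fun_prop)).cexp)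
  exact h.contDiffOn.exists_lipschitzOnWith one_ne_zero (convex_Icc 0 1) isCompact_Icc

theorem image_expCircle (w₀ : ℂ) {r : ℝ} (hr : 0 < r) :
    expCircle w₀ r '' Set.Icc 0 1 = (fun ζ => w₀ * Complex.exp ζ) '' Metric.sphere 0 r := by
  refine Set.Subset.antisymm ?_ ?_
  · rintro _ ⟨t, -, rfl⟩
    exact ⟨_, circleMap_mem_sphere 0 hr.le _, rfl⟩
  · rintro _ ⟨ζ, hζ, rfl⟩
    rw [← abs_of_pos hr, ← image_circleMap_Ioc] at hζ
    obtain ⟨θ, hθ, rfl⟩ := hζ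
    refine ⟨θ / (2 * Real.pi), ⟨by have := hθ.1; positivity, ?_⟩, ?_⟩
    · rw [div_le_one (by positivity)]
      exact hθ.2
    · simp only [expCircle]
      rw [mul_div_cancel₀ _ (by positivity)]

/-- Cauchy's formula transplanted by the exponential. -/
theorem circleIntegral_exp_cauchy {w₀ : ℂ} (hw₀ : w₀ ≠ 0) {r : ℝ}
    (hrpi : r ≤ Real.pi) {F : ℂ → ℂ} (hF : DiffContOnCl ℂ F (Metric.ball 0 r)) {ζ₀ : ℂ}
    (hζ₀ : ζ₀ ∈ Metric.ball (0 : ℂ) r) :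
    (2 * (Real.pi : ℂ) * Complex.I)⁻¹ * (∮ ζ in C(0, r), F ζ *
      (1 / (w₀ * Complex.exp ζ - w₀ * Complex.exp ζ₀)) * (w₀ * Complex.exp ζ)) = F ζ₀ := by
  have hζ₀' : ‖ζ₀‖ < r := by simpa using hζ₀
  have hr : 0 < r := (norm_nonneg _).trans_lt hζ₀'
  have hdist : ∀ ζ : ℂ, ‖ζ‖ ≤ r → ‖ζ - ζ₀‖ < 2 * Real.pi := fun ζ hζ =>
    (norm_sub_le _ _).trans_lt (by linarith)
  -- The pulled-back Cauchy kernel is `J ζ/(ζ - ζ₀)`, with `J` holomorphic near the closed disc and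
  -- `J ζ₀ = 1`. Points of the closed disc are less than `2π` from `ζ₀` because `r ≤ π`.
  set J : ℂ → ℂ := fun ζ => Complex.exp (ζ - ζ₀) * (dslope Complex.exp 0 (ζ - ζ₀))⁻¹ with hJ
  have hJd : DiffContOnCl ℂ J (Metric.ball 0 r) := by
    refine DifferentiableOn.diffContOnCl fun ζ hζ => ?_
    have hζ' : ‖ζ‖ ≤ r := by simpa using Metric.closure_ball_subset_closedBall hζ
    have hd := differentiable_dslope Complex.differentiable_exp 0
    have hd2 : DifferentiableAt ℂ (fun ζ => dslope Complex.exp 0 (ζ - ζ₀)) ζ :=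
      (hd _).comp ζ (differentiableAt_id.sub_const ζ₀)
    exact (DifferentiableAt.mul (by fun_prop)
      (hd2.inv (dslope_exp_ne_zero (hdist ζ hζ')))).differentiableWithinAt
  have hFJ : DiffContOnCl ℂ (fun ζ => F ζ • J ζ) (Metric.ball 0 r) := hF.smul hJd
  have h := hFJ.circleIntegral_sub_inv_smul hζ₀
  have hJ0 : J ζ₀ = 1 := by simp [hJ]
  have e : (∮ ζ in C(0, r), F ζ *
      (1 / (w₀ * Complex.exp ζ - w₀ * Complex.exp ζ₀)) * (w₀ * Complex.exp ζ)) =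
      ∮ ζ in C(0, r), (ζ - ζ₀)⁻¹ • (F ζ • J ζ) := by
    refine circleIntegral.integral_congr hr.le fun ζ hζ => ?_
    have hζ' : ‖ζ‖ = r := by simpa using hζ
    have h1 : Complex.exp ζ = Complex.exp ζ₀ * Complex.exp (ζ - ζ₀) := by
      rw [← Complex.exp_add, add_sub_cancel]
    have h2 : w₀ * Complex.exp ζ - w₀ * Complex.exp ζ₀ =
        w₀ * Complex.exp ζ₀ * ((ζ - ζ₀) * dslope Complex.exp 0 (ζ - ζ₀)) := by
      rw [← exp_sub_one_eq_mul_dslope, h1]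
      ring
    have h3 : ζ - ζ₀ ≠ 0 := fun h => by
      rw [sub_eq_zero.1 h] at hζ'
      exact hζ₀'.ne hζ'
    have h4 := dslope_exp_ne_zero (hdist ζ hζ'.le)
    have h5 := Complex.exp_ne_zero ζ₀
    simp only [smul_eq_mul, hJ]
    rw [h2, h1]
    field_simp
  rw [e, h, smul_eq_mul, hJ0]
  have : (Real.pi : ℂ) ≠ 0 := by exact_mod_cast Real.pi_ne_zero
  simp only [smul_eq_mul, mul_one]
  field_simp

theorem isBoundaryCycle_expCircle {w₀ : ℂ} (hw₀ : w₀ ≠ 0) {r : ℝ} (hr : 0 < r)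
    (hrpi : r ≤ Real.pi) (hopen : IsOpen ((fun ζ => w₀ * Complex.exp ζ) '' Metric.ball 0 r)) :
    IsBoundaryCycle (fun _ : Fin 1 => expCircle w₀ r)
      ((fun ζ => w₀ * Complex.exp ζ) '' Metric.ball 0 r) where
  lipschitz _ := lipschitzOnWith_expCircle w₀ r
  closed _ := by simp [expCircle, circleMap]
  image_eq := by
    rw [Set.iUnion_const, image_expCircle w₀ hr,
      frontier_image_const_mul_exp_ball hw₀ hr hrpi hopen]
  winding_interior := by
    rintro _ ⟨ζ₀, hζ₀, rfl⟩
    have h := circleIntegral_exp_cauchy hw₀ hrpi (F := fun _ => 1) diffContOnCl_const hζ₀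
    simp only [one_mul] at h
    simp only [cycleWindingNumber, cycleContourIntegral, Finset.univ_unique, Finset.sum_const,
      Finset.card_singleton, one_smul]
    rw [curveContourIntegral_expCircle, h]
  winding_exterior := by
    intro z hz
    simp only [cycleWindingNumber, cycleContourIntegral, Finset.univ_unique, Finset.sum_const,
      Finset.card_singleton, one_smul]
    rw [curveContourIntegral_expCircle]
    have hd : DifferentiableOn ℂ (fun ζ => 1 / (w₀ * Complex.exp ζ - z) * (w₀ * Complex.exp ζ))
        (Metric.closedBall 0 r) := by
      intro ζ hζ
      have hne : w₀ * Complex.exp ζ - z ≠ 0 := fun h => by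
        refine hz ?_
        rw [closure_image_const_mul_exp_ball hw₀ hr, ← image_const_mul_exp_closedBall hw₀,
          ← sub_eq_zero.1 h]
        exact ⟨ζ, hζ, rfl⟩
      refine DifferentiableAt.differentiableWithinAt (DifferentiableAt.mul ?_ (by fun_prop))
      exact (differentiableAt_const _).div (by fun_prop) hne
    rw [(Complex.circleIntegral_eq_zero_of_differentiable_on_off_countable hr.le
      Set.countable_empty hd.continuousOn fun ζ hζ => (hd ζ
        (Metric.ball_subset_closedBall hζ.1)).differentiableAt
          (Filter.mem_of_superset (Metric.isOpen_ball.mem_nhds hζ.1) Metric.ball_subset_closedBall)),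
      mul_zero]

theorem isBoundedLQD_image_const_mul_exp_ball {w₀ : ℂ} (hw₀ : w₀ ≠ 0) {r : ℝ} (hr : 0 < r)
    (hrpi : r ≤ Real.pi) (hopen : IsOpen ((fun ζ => w₀ * Complex.exp ζ) '' Metric.ball 0 r))
    {α : ℂ} (hα : α = ((r ^ 2 : ℝ) : ℂ)) :
    IsBoundedLQD ((fun ζ => w₀ * Complex.exp ζ) '' Metric.ball 0 r)
      (RatFunc.C α / (RatFunc.X - RatFunc.C w₀)) := by
  have hα0 : α ≠ 0 := by
    rw [hα]
    exact_mod_cast (pow_pos hr 2).ne'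
  have hc : Continuous fun ζ => w₀ * Complex.exp ζ := by fun_prop
  refine ⟨hopen, ?_, ?_, interior_closure_image_const_mul_exp_ball hw₀ hr hopen, ?_, ⟨?_, ?_⟩,
    ⟨1, _, isBoundaryCycle_expCircle hw₀ hr hrpi hopen, fun f hf => ?_⟩⟩
  · exact (Metric.isConnected_ball hr).image _ hc.continuousOn
  · exact ((isCompact_closedBall (0 : ℂ) r).image hc).isBounded.subset
      (Set.image_mono Metric.ball_subset_closedBall)
  · intro h
    have := frontier_subset_closure h
    rw [closure_image_const_mul_exp_ball hw₀ hr] at this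
    exact this.1 rfl
  · rw [(simplePole_num_denom hα0 w₀).1, (simplePole_num_denom hα0 w₀).2,
      Polynomial.degree_C hα0, Polynomial.degree_X_sub_C]
    exact zero_lt_one
  · intro z hz
    rw [(simplePole_num_denom hα0 w₀).2] at hz
    simp only [Polynomial.IsRoot.def, Polynomial.eval_sub, Polynomial.eval_X,
      Polynomial.eval_C, sub_eq_zero] at hz
    exact ⟨0, by simpa using hr, by simp [hz]⟩
  · have hF : DiffContOnCl ℂ (fun ζ => f (w₀ * Complex.exp ζ)) (Metric.ball 0 r) := by
      have hd : Differentiable ℂ fun ζ => w₀ * Complex.exp ζ := by fun_prop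
      exact hf.diffContOnCl.comp hd.diffContOnCl (Set.mapsTo_image _ _)
    rw [setIntegral_image_const_mul_exp hw₀ Metric.isOpen_ball.measurableSet
      (injOn_const_mul_exp_ball hw₀ hrpi), setIntegral_ball_of_diffContOnCl hr hF]
    simp only [cycleContourIntegral, Finset.univ_unique, Finset.sum_const,
      Finset.card_singleton, one_smul]
    rw [curveContourIntegral_expCircle]
    -- The pole `w₀` corresponds to the centre `ζ₀ = 0`, so both sides equal `r² f(w₀)`.
    have h := circleIntegral_exp_cauchy hw₀ hrpi (hF.const_smul α) (ζ₀ := 0) (by simpa using hr)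
    have e : (∮ ζ in C(0, r), f (w₀ * Complex.exp ζ) *
        (RatFunc.C α / (RatFunc.X - RatFunc.C w₀)).eval (RingHom.id ℂ) (w₀ * Complex.exp ζ) *
          (w₀ * Complex.exp ζ)) =
        ∮ ζ in C(0, r), (α • fun ζ => f (w₀ * Complex.exp ζ)) ζ *
        (1 / (w₀ * Complex.exp ζ - w₀ * Complex.exp 0)) * (w₀ * Complex.exp ζ) := by
      congr 1
      ext ζ
      rw [eval_simplePole hα0, Complex.exp_zero, mul_one, Pi.smul_apply, smul_eq_mul]
      ring
    rw [e, h, Pi.smul_apply, smul_eq_mul, hα]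
    have : (Real.pi : ℂ) ≠ 0 := by exact_mod_cast Real.pi_ne_zero
    push_cast
    field_simp

end

theorem theorem3p2 (α w₀ : ℂ) (hα : α ≠ 0) (hw₀ : w₀ ≠ 0) (Ω : Set ℂ)
    (hΩ_open : IsOpen Ω) (hΩ_sc : IsSimplyConnected Ω)
    (hΩ_bdd : Bornology.IsBounded Ω) (hΩ_zero : (0 : ℂ) ∉ Ω) :
    IsBoundedLQD Ω (RatFunc.C α / (RatFunc.X - RatFunc.C w₀)) ↔
      (α.im = 0 ∧ 0 < α.re ∧ α.re ≤ Real.pi ^ 2 ∧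
        Ω = {w : ℂ | w ≠ 0 ∧ ‖Complex.log (w / w₀)‖ ^ 2 < α.re}) := by
  have hset : {w : ℂ | w ≠ 0 ∧ ‖Complex.log (w / w₀)‖ ^ 2 < α.re} =
      (fun ζ => w₀ * Complex.exp ζ) '' Metric.ball 0 (Real.sqrt α.re) := by
    rw [image_const_mul_exp_ball hw₀]
    ext w
    simp only [Set.mem_ofPred_eq, Real.lt_sqrt (norm_nonneg _)]
  rw [hset]
  constructor
  · exact fun h => h.eq_of_simplePole hα hw₀ hΩ_sc hΩ_zero
  · rintro ⟨him, hre, hpi, rfl⟩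
    refine isBoundedLQD_image_const_mul_exp_ball hw₀ (Real.sqrt_pos.2 hre)
      (Real.sqrt_le_iff.2 ⟨Real.pi_pos.le, hpi⟩) hΩ_open ?_
    rw [Real.sq_sqrt hre.le]
    exact Complex.ext rfl him
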